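/- Let $d\ge 0$ and let $w_\alpha\ge 0$ ($\alpha\in\mathbb N_0^d$) satisfy $\sum_\alpha w_\alpha/(\alpha!)^2<\infty$. Let $k(x,y)=\sum_\alpha w_\alpha x^\alpha y^\alpha/(\alpha!)^2$ be the corresponding power series kernel on $(-1,1)^d$ (it is automatically smooth there), and let $\mathcal H$ be its RKHS (native space), i.e. the space of the functions $f(x)=\sum_{w_\alpha>0}c_\alpha x^\alpha$ with $\sum_{w_\alpha>0}(\alpha!)^2c_\alpha^2/w_\alpha<\infty$, with inner product $\langle f,g\rangle=\sum_{w_\alpha>0}(\alpha!)^2c_\alpha d_\alpha/w_\alpha$ for $g(x)=\sum_{w_\alpha>0} d_\alpha x^\alpha$. For $\xi\in[0,1]^d$ and $f\in\mathcal H$ let $f_\xi(z)=f(\xi\circ z)$, where $\circ$ is the coordinatewise product; then $f_\xi\in\mathcal H$. Let $\mathcal Z\subset(-1,1)^d$ be compact with $\xi\circ z\in\mathcal Z$ for all $\xi\in[0,1]^d$, $z\in\mathcal Z$. Let $z_1,z_2,\ldots$ be i.i.d. with law $P$ on $\mathcal Z$ and $z_1',z_2',\ldots$ i.i.d. with law $Q$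 on $\mathcal Z$ (no relation between the two samples is assumed). Let $\mathcal I,\mathcal J$ be finite collections of finite subsets, or more generally of finite multisets, of $\{1,\ldots,d\}$; for $I=\{i_1,\ldots,i_a\}$ write $\partial_I=\partial^a/\partial z_{i_1}\cdots\partial z_{i_a}$, and let $\partial_Ik(z,\cdot)\in\mathcal H$ be the derivative with respect to the first argument. Let $h_I$ ($I\in\mathcal I$), $\bar h_J$ ($J\in\mathcal J$) be bounded measurable functions on $\mathcal Z$. With $(u\otimes v)f=\langle v,f\rangle u$ put $$\widehat C=\frac1n\sum_{\ell=1}^n\sum_{I\in\mathcal I}h_I(z_\ell)\,\partial_Ik(z_\ell,\cdot)\otimes\partial_Ik(z_\ell,\cdot),\qquad \widehat g=\frac1{n'}\sum_{\ell=1}^{n'}\sum_{J\in\mathcal J}\bar h_J(z'_\ell)\,\partial_Jk(z'_\ell,\cdot),$$ let $C$ and $g$ be their expectations (they exist as Bochner integrals), and for $\xi\in[0,1]^d$, $f\in\mathcal H$ let $$\widehat L(\xi;f)=\tfrac12\langle f_\xi,\widehat Cf_\xi\rangle-\langle\widehat g,f_\xi\rangle,\qquad L(\xi;f)=\tfrac12\langle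 f_\xi,Cf_\xi\rangle-\langle g,f_\xi\rangle .$$ Let the sample sizes $n=n_m$ and $n'=n'_m$ tend to infinity as $m\to\infty$, put $s=s_m=\min\{n_m,n'_m\}$, let $f^*\in\mathcal H$, and let $\widehat f=\widehat f_m$ be an $\mathcal H$-valued estimator with $\|\widehat f-f^*\|=o_P(1)$. Then, for every $f\in\mathcal H$, $\widehat L(\xi;f)$ and $L(\xi;f)$ have partial derivatives with respect to each $\xi_i$ at every $\xi\in[0,1]^d$ (one-sided on the boundary), and: (a) there is a positive non-increasing sequence $\delta_s\to0$ such that, for $i=1,\ldots,d$, $$\sup_{\xi\in[0,1]^d}\Big|\frac{\partial}{\partial\xi_i}\widehat L(\xi;\widehat f)-\frac{\partial}{\partial\xi_i}\widehat L(\xi;f^*)\Big|=O_P(\delta_{s_m})\quad(m\to\infty);$$ (b) with $\delta'_s=\sqrt{\log s/s}$, which decreases to $0$ for $s\ge3$, for $i=1,\ldots,d$, $$\sup_{\xi\in[0,1]^d}\Big|\frac{\partial}{\partial\xi_i}\widehat L(\xi;f^*)-\frac{\partial}{\partial\xi_i}L(\xi;f^*)\Big|=O_P(\delta'_{s_m})\quad(m\to\infty).$$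 -/

import Mathlib

open MeasureTheory ProbabilityTheory Filter Topology
open scoped ENNReal

noncomputable section

/-- The open cube `(-1,1)^d`. -/
def openCube (d : ℕ) : Set (Fin d → ℝ) := {x | ∀ i, x i ∈ Set.Ioo (-1 : ℝ) 1}

/-- The multi-index factorial `α! = α₁! ⋯ α_d!`. -/
def mfact {d : ℕ} (α : Fin d → ℕ) : ℝ := ∏ i, ((α i).factorial : ℝ)

/-- The monomial `x^α = x₁^α₁ ⋯ x_d^α_d`. -/
def mpow {d : ℕ} (x : Fin d → ℝ) (α : Fin d → ℕ) : ℝ := ∏ i, x i ^ α i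

/-- The weights of a power series kernel: non-negative numbers `w_α`, `α ∈ ℕ^d`, with
`∑_α w_α / (α!)² < ∞`. -/
structure PSWeights (d : ℕ) where
  /-- the weights -/
  w : (Fin d → ℕ) → ℝ
  nonneg : ∀ α, 0 ≤ w α
  summable : Summable fun α => w α / mfact α ^ 2

namespace PSWeights

variable {d : ℕ} (K : PSWeights d)

/-- The power series kernel `k(x,y) = ∑_α w_α x^α y^α / (α!)²`. -/
def kernel (x y : Fin d → ℝ) : ℝ := ∑' α, K.w α * (mpow x α * mpow y α) / mfact α ^ 2

/-- The multi-indices `α` with `w_α > 0`. -/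
abbrev Supp : Type := {α : Fin d → ℕ // 0 < K.w α}

/-- The native space of the kernel. The power series `f = ∑_α c_α x^α` (over `w_α > 0`) with
`∑_α (α!)² c_α² / w_α < ∞` is stored through its coordinates `a_α = (α! / √w_α) c_α`, which form an
arbitrary square summable family; see `coeff`, `inner_eq` and `exists_coeff_iff`. -/
def NativeSpace : Type := lp (fun _ : K.Supp => ℝ) 2

instance : NormedAddCommGroup K.NativeSpace :=
  inferInstanceAs (NormedAddCommGroup (lp (fun _ : K.Supp => ℝ) 2))

instance : InnerProductSpace ℝ K.NativeSpace :=
  inferInstanceAs (InnerProductSpace ℝ (lp (fun _ : K.Supp => ℝ) 2))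

instance : CompleteSpace K.NativeSpace :=
  inferInstanceAs (CompleteSpace (lp (fun _ : K.Supp => ℝ) 2))

/-- The coordinate of `f` at `α`. -/
def coord (f : K.NativeSpace) (α : K.Supp) : ℝ :=
  (show lp (fun _ : K.Supp => ℝ) 2 from f) α

open Classical in
/-- The Taylor coefficient `c_α` of `f = ∑_α c_α x^α`. -/
def coeff (f : K.NativeSpace) (α : Fin d → ℕ) : ℝ :=
  if h : 0 < K.w α then √(K.w α) / mfact α * K.coord f ⟨α, h⟩ else 0

theorem mfact_pos (α : Fin d → ℕ) : 0 < mfact α :=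
  Finset.prod_pos fun i _ => by exact_mod_cast (α i).factorial_pos

theorem memlp_iff (a : K.Supp → ℝ) :
    Memℓp (E := fun _ : K.Supp => ℝ) a 2 ↔ Summable fun α => a α ^ 2 := by
  rw [memℓp_gen_iff (by norm_num)]
  simp

/-- The element with the given square summable coordinates. -/
def ofCoord (a : K.Supp → ℝ) (h : Summable fun α => a α ^ 2) : K.NativeSpace :=
  (⟨a, (K.memlp_iff a).2 h⟩ : lp (fun _ : K.Supp => ℝ) 2)

@[simp] theorem coord_ofCoord (a : K.Supp → ℝ) (h : Summable fun α => a α ^ 2) (α : K.Supp) :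
    K.coord (K.ofCoord a h) α = a α := rfl

theorem coord_ext {f g : K.NativeSpace} (h : ∀ α, K.coord f α = K.coord g α) : f = g :=
  lp.ext (funext h)

theorem summable_coord_sq (f : K.NativeSpace) : Summable fun α => K.coord f α ^ 2 :=
  (K.memlp_iff _).1 (lp.memℓp (show lp (fun _ : K.Supp => ℝ) 2 from f))

theorem hasSum_inner (f g : K.NativeSpace) :
    HasSum (fun α => K.coord f α * K.coord g α) (inner ℝ f g) := by
  have h := lp.hasSum_inner (𝕜 := ℝ) (show lp (fun _ : K.Supp => ℝ) 2 from f)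
    (show lp (fun _ : K.Supp => ℝ) 2 from g)
  have he : (fun α => K.coord f α * K.coord g α) = fun α => inner ℝ (K.coord f α) (K.coord g α) :=
    funext fun α => by simp [mul_comm]
  rw [he]
  exact h

theorem coeff_coe (f : K.NativeSpace) (α : K.Supp) :
    K.coeff f α = √(K.w α) / mfact α.1 * K.coord f α := by
  simp [coeff, α.2]

/-- The inner product of the native space, `⟨f,g⟩ = ∑_α (α!)² c_α d_α / w_α`. -/
theorem inner_eq (f g : K.NativeSpace) :
    inner ℝ f g = ∑' α : K.Supp, mfact α.1 ^ 2 * (K.coeff f α * K.coeff g α) / K.w α := by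
  rw [← (K.hasSum_inner f g).tsum_eq]
  refine tsum_congr fun α => ?_
  rw [coeff_coe, coeff_coe]
  have h1 := mfact_pos α.1
  have h2 := α.2
  have h3 : √(K.w α.1) ^ 2 = K.w α.1 := Real.sq_sqrt h2.le
  field_simp
  rw [h3]

/-- The coefficient families that occur are exactly those of the native space. -/
theorem exists_coeff_iff (c : K.Supp → ℝ) :
    (∃ f : K.NativeSpace, ∀ α : K.Supp, K.coeff f α = c α) ↔
      Summable fun α : K.Supp => mfact α.1 ^ 2 * c α ^ 2 / K.w α := by
  have key : ∀ α : K.Supp, mfact α.1 ^ 2 * c α ^ 2 / K.w α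
      = (mfact α.1 / √(K.w α) * c α) ^ 2 := fun α => by
    rw [mul_pow, div_pow, Real.sq_sqrt α.2.le]; ring
  constructor
  · rintro ⟨f, hf⟩
    refine (K.summable_coord_sq f).congr fun α => ?_
    rw [key, ← hf, coeff_coe]
    have h1 := (mfact_pos α.1).ne'
    have h2 := (Real.sqrt_pos.2 α.2).ne'
    field_simp
  · intro h
    refine ⟨K.ofCoord (fun α => mfact α.1 / √(K.w α) * c α) (h.congr fun α => key α), fun α => ?_⟩
    rw [coeff_coe, coord_ofCoord]
    have h1 := (mfact_pos α.1).ne'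
    have h2 := (Real.sqrt_pos.2 α.2).ne'
    field_simp

theorem abs_mpow_le_one {x : Fin d → ℝ} (hx : ∀ i, |x i| ≤ 1) (α : Fin d → ℕ) :
    |mpow x α| ≤ 1 := by
  rw [mpow, Finset.abs_prod]
  refine Finset.prod_le_one (fun i _ => abs_nonneg _) fun i _ => ?_
  rw [abs_pow]
  exact pow_le_one₀ (abs_nonneg _) (hx i)

theorem abs_le_one_of_mem {x : Fin d → ℝ} (hx : x ∈ openCube d) (i : Fin d) : |x i| ≤ 1 :=
  abs_le.2 ⟨(hx i).1.le, (hx i).2.le⟩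

theorem summable_kerCoord {x : Fin d → ℝ} (hx : x ∈ openCube d) :
    Summable fun α : K.Supp => (√(K.w α) / mfact α.1 * mpow x α) ^ 2 := by
  refine Summable.of_nonneg_of_le (fun _ => sq_nonneg _) (fun α => ?_)
    (K.summable.comp_injective (Subtype.val_injective (p := fun α => 0 < K.w α)))
  rw [mul_pow, div_pow, Real.sq_sqrt α.2.le]
  have h : mpow x α.1 ^ 2 ≤ 1 :=
    (sq_le_one_iff_abs_le_one _).2 (abs_mpow_le_one (abs_le_one_of_mem hx) α.1)
  exact mul_le_of_le_one_right (div_nonneg α.2.le (sq_nonneg _)) h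

open Classical in
/-- The canonical feature map `z ↦ k(z,·)` on `(-1,1)^d` (extended by `0`). -/
def feature (z : Fin d → ℝ) : K.NativeSpace :=
  if hz : z ∈ openCube d then K.ofCoord (fun α => √(K.w α) / mfact α.1 * mpow z α)
    (K.summable_kerCoord hz) else 0

theorem hasSum_inner_feature {x : Fin d → ℝ} (hx : x ∈ openCube d) (f : K.NativeSpace) :
    HasSum (fun α => K.coeff f α * mpow x α) (inner ℝ (K.feature x) f) := by
  have h := K.hasSum_inner (K.feature x) f
  have hs : Function.support (fun α => K.coeff f α * mpow x α) ⊆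
      Set.range (Subtype.val : K.Supp → _) := by
    intro α hα
    by_contra hn
    apply hα
    have : ¬ 0 < K.w α := fun h0 => hn ⟨⟨α, h0⟩, rfl⟩
    simp [coeff, this]
  rw [← Function.Injective.hasSum_iff Subtype.val_injective
    (fun α hα => by_contra fun h0 => hα (hs h0))]
  have he : (fun α => K.coeff f α * mpow x α) ∘ Subtype.val =
      fun α => K.coord (K.feature x) α * K.coord f α := by
    funext α
    simp only [Function.comp, coeff_coe, feature, dif_pos hx, coord_ofCoord]
    ring
  rw [he]
  exact h

theorem coeff_feature {x : Fin d → ℝ} (hx : x ∈ openCube d) (α : Fin d → ℕ) :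
    K.coeff (K.feature x) α = K.w α * mpow x α / mfact α ^ 2 := by
  by_cases h : 0 < K.w α
  · have h3 : √(K.w α) ^ 2 = K.w α := Real.sq_sqrt h.le
    simp only [coeff, dif_pos h, feature, dif_pos hx, coord_ofCoord]
    have h1 := mfact_pos α
    field_simp
    rw [h3]
    ring
  · have h0 : K.w α = 0 := le_antisymm (not_lt.1 h) (K.nonneg α)
    simp [coeff, h0]

/-- An absolutely convergent power series that vanishes on the cube has zero coefficients. -/
theorem coeff_eq_zero_of_forall {c : (Fin d → ℕ) → ℝ}
    (hc : ∀ x ∈ openCube d, HasSum (fun α => c α * mpow x α) 0) : c = 0 := by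
  classical
  have hom : ∀ x ∈ openCube d, ∀ m : ℕ,
      ∑ α ∈ Finset.piAntidiag Finset.univ m, c α * mpow x α = 0 := by
    intro x hx
    set b : ℕ → ℝ := fun m => ∑ α ∈ Finset.piAntidiag Finset.univ m, c α * mpow x α with hb
    let p : FormalMultilinearSeries ℝ ℝ ℝ := FormalMultilinearSeries.ofScalars ℝ b
    have hp : HasFPowerSeriesAt (fun _ : ℝ => (0 : ℝ)) p 0 := by
      rw [hasFPowerSeriesAt_iff]
      filter_upwards [Metric.ball_mem_nhds (0 : ℝ) one_pos] with t ht
      have ht1 : |t| < 1 := by simpa using ht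
      have hmem : (fun i => t * x i) ∈ openCube d := fun i => by
        have : |t * x i| < 1 := by
          rw [abs_mul]
          exact mul_lt_one_of_nonneg_of_lt_one_left (abs_nonneg _) ht1 (abs_le_one_of_mem hx i)
        exact ⟨(abs_lt.1 this).1, (abs_lt.1 this).2⟩
      have h1 := (hc _ hmem).tsum_fiberwise fun α => ∑ i, α i
      refine (funext fun m => ?_ : (fun n => t ^ n • p.coeff n) = _) ▸ h1
      have hset : (fun α : Fin d → ℕ => ∑ i, α i) ⁻¹' {m} =
          ((Finset.piAntidiag Finset.univ m : Finset (Fin d → ℕ)) : Set (Fin d → ℕ)) := by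
        ext α; simp
      have h2 : (∑' α : ((fun α : Fin d → ℕ => ∑ i, α i) ⁻¹' {m}),
          c α * mpow (fun i => t * x i) α) = t ^ m * b m := by
        rw [hset, Finset.tsum_subtype' (Finset.piAntidiag Finset.univ m)
          (fun α : Fin d → ℕ => c α * mpow (fun i => t * x i) α), hb, Finset.mul_sum]
        refine Finset.sum_congr rfl fun α hα => ?_
        have hm : ∑ i, α i = m := (Finset.mem_piAntidiag.1 hα).1
        simp only [mpow, mul_pow, Finset.prod_mul_distrib, Finset.prod_pow_eq_pow_sum, hm]
        ring
      rw [h2]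
      simp [p]
    intro m
    have h0 : p = 0 := hp.eq_zero
    have : p.coeff m = b m := by simp [p]
    change b m = 0
    rw [← this, h0]
    rfl
  funext α
  let m := ∑ i, α i
  let e : (Fin d → ℕ) ≃ (Fin d →₀ ℕ) := Finsupp.equivFunOnFinite.symm
  let P : MvPolynomial (Fin d) ℝ :=
    ∑ β ∈ Finset.piAntidiag Finset.univ m, MvPolynomial.monomial (e β) (c β)
  have hP : P = 0 := by
    refine MvPolynomial.funext_set (fun _ => Set.Ioo (-1 : ℝ) 1)
      (fun _ => Set.Ioo_infinite (by norm_num)) fun x hx => ?_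
    have hx' : x ∈ openCube d := fun i => hx i (Set.mem_univ i)
    rw [map_zero, ← hom x hx' m, map_sum]
    refine Finset.sum_congr rfl fun β _ => ?_
    rw [MvPolynomial.eval_monomial, Finsupp.prod_fintype _ _ (by simp)]
    rfl
  have hcoef : MvPolynomial.coeff (e α) P = c α := by
    simp only [P, MvPolynomial.coeff_sum, MvPolynomial.coeff_monomial, e.injective.eq_iff]
    rw [Finset.sum_ite_eq' (Finset.piAntidiag Finset.univ m) α c, if_pos (by simp [m])]
  rw [← hcoef, hP]
  simp

theorem coeff_ext {f g : K.NativeSpace} (h : K.coeff f = K.coeff g) : f = g := by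
  refine K.coord_ext fun α => ?_
  have h1 := congrFun h α.1
  rw [coeff_coe, coeff_coe] at h1
  exact mul_left_cancel₀ (div_pos (Real.sqrt_pos.2 α.2) (mfact_pos α.1)).ne' h1

/-- The native space is a reproducing kernel Hilbert space of functions on `(-1,1)^d`, the values
being `f(x) = ∑_α c_α x^α` (`apply_eq`) and the kernel being `k` (`kernel_eq`). -/
instance : RKHS ℝ K.NativeSpace (openCube d) ℝ where
  coeCLM := ContinuousLinearMap.pi fun x => innerSL ℝ (K.feature x)
  coeCLM_injective := by
    intro f g hfg
    refine K.coeff_ext (sub_eq_zero.1 (coeff_eq_zero_of_forall fun x hx => ?_))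
    have h1 := (K.hasSum_inner_feature hx f).sub (K.hasSum_inner_feature hx g)
    have h2 : inner ℝ (K.feature x) f = inner ℝ (K.feature x) g := congrFun hfg ⟨x, hx⟩
    rw [h2, sub_self] at h1
    simpa [sub_mul] using h1

/-- The reproducing property. -/
theorem inner_feature (x : openCube d) (f : K.NativeSpace) : inner ℝ (K.feature x) f = f x := rfl

theorem apply_eq (f : K.NativeSpace) (x : openCube d) : f x = ∑' α, K.coeff f α * mpow x α :=
  (K.hasSum_inner_feature x.2 f).tsum_eq.symm

/-- `feature x` is the function `k(x,·)`. -/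
theorem feature_apply (x y : openCube d) : K.feature x y = K.kernel x y := by
  rw [apply_eq, kernel]
  refine tsum_congr fun α => ?_
  rw [coeff_feature K x.2]
  ring

theorem kernel_eq (x y : openCube d) : RKHS.kernel K.NativeSpace x y 1 = K.kernel y x := by
  rw [← RKHS.kerFun_apply, ← K.feature_apply]
  congr 1
  refine ext_inner_right ℝ fun f => ?_
  rw [RKHS.kerFun_inner, inner_feature]
  simp

/-- The scaled function `f_ξ(z) = f(ξ ∘ z)` for `ξ ∈ [0,1]^d`, see `scale_apply`; its coefficients
are `c_α ξ^α`. (It is not used for other `ξ`.) -/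
def scale (ξ : Fin d → ℝ) (f : K.NativeSpace) : K.NativeSpace :=
  open Classical in
  if hξ : ∀ i, ξ i ∈ Set.Icc (0 : ℝ) 1 then K.ofCoord (fun α => mpow ξ α * K.coord f α)
    (Summable.of_nonneg_of_le (fun _ => sq_nonneg _) (fun α => by
      rw [mul_pow]
      exact mul_le_of_le_one_left (sq_nonneg _) ((sq_le_one_iff_abs_le_one _).2
        (abs_mpow_le_one (fun i => abs_le.2 ⟨by linarith [(hξ i).1], (hξ i).2⟩) α.1)))
      (K.summable_coord_sq f)) else 0

theorem mul_mem_openCube {ξ z : Fin d → ℝ} (hξ : ∀ i, ξ i ∈ Set.Icc (0 : ℝ) 1)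
    (hz : z ∈ openCube d) : ξ * z ∈ openCube d := fun i => by
  have h : |ξ i * z i| < 1 := by
    rw [abs_mul, abs_of_nonneg (hξ i).1]
    exact mul_lt_one_of_nonneg_of_lt_one_right (hξ i).2 (abs_nonneg _)
      (abs_lt.2 ⟨(hz i).1, (hz i).2⟩)
  exact ⟨(abs_lt.1 h).1, (abs_lt.1 h).2⟩

theorem scale_apply {ξ : Fin d → ℝ} (hξ : ∀ i, ξ i ∈ Set.Icc (0 : ℝ) 1) (f : K.NativeSpace)
    (z : openCube d) : K.scale ξ f z = f ⟨ξ * z, mul_mem_openCube hξ z.2⟩ := by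
  rw [apply_eq, apply_eq]
  refine tsum_congr fun α => ?_
  by_cases h : 0 < K.w α
  · simp only [coeff, dif_pos h, scale, dif_pos hξ, coord_ofCoord, mpow, Pi.mul_apply, mul_pow,
      Finset.prod_mul_distrib]
    ring
  · simp [coeff, dif_neg h]

end PSWeights

/-- The partial derivative `∂_i F`. -/
def partialD {d : ℕ} {E : Type*} [NormedAddCommGroup E] [NormedSpace ℝ E] (i : Fin d)
    (F : (Fin d → ℝ) → E) (z : Fin d → ℝ) : E :=
  lineDeriv ℝ F z (Pi.single i 1)

/-- The iterated partial derivative `∂_I F = ∂_{i₁} ⋯ ∂_{i_k} F` for a finite multiset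
`I = {i₁, …, i_k}` of coordinates. (For smooth `F` the order is irrelevant.) -/
def partialMulti {d : ℕ} {E : Type*} [NormedAddCommGroup E] [NormedSpace ℝ E]
    (I : Multiset (Fin d)) (F : (Fin d → ℝ) → E) : (Fin d → ℝ) → E :=
  I.toList.foldr partialD F

namespace PSWeights

variable {d : ℕ} (K : PSWeights d)

/-- The element `∂_I k(z,·)` of the native space: the derivative at `z` of `z ↦ k(z,·)`. -/
def kernelDeriv (I : Multiset (Fin d)) (z : Fin d → ℝ) : K.NativeSpace :=
  partialMulti I K.feature z

variable {Z : Set (Fin d → ℝ)}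

/-- `∑_{I ∈ 𝓘} h_I(z) ∂_I k(z,·) ⊗ ∂_I k(z,·)`. -/
def opTerm (𝓘 : Finset (Multiset (Fin d))) (h : Multiset (Fin d) → Z → ℝ) (z : Z) :
    K.NativeSpace →L[ℝ] K.NativeSpace :=
  ∑ I ∈ 𝓘, h I z • InnerProductSpace.rankOne ℝ (K.kernelDeriv I z) (K.kernelDeriv I z)

/-- `∑_{J ∈ 𝓙} h_J(z) ∂_J k(z,·)`. -/
def vecTerm (𝓙 : Finset (Multiset (Fin d))) (h : Multiset (Fin d) → Z → ℝ) (z : Z) :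
    K.NativeSpace :=
  ∑ J ∈ 𝓙, h J z • K.kernelDeriv J z

/-- The empirical operator `Ĉ` of the sample `z 0, …, z (n-1)`. -/
def empOp (𝓘 : Finset (Multiset (Fin d))) (h : Multiset (Fin d) → Z → ℝ) (n : ℕ) (z : ℕ → Z) :
    K.NativeSpace →L[ℝ] K.NativeSpace :=
  (n : ℝ)⁻¹ • ∑ l ∈ Finset.range n, K.opTerm 𝓘 h (z l)

/-- The empirical element `ĝ` of the sample `z 0, …, z (n-1)`. -/
def empVec (𝓙 : Finset (Multiset (Fin d))) (h : Multiset (Fin d) → Z → ℝ) (n : ℕ) (z : ℕ → Z) :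
    K.NativeSpace :=
  (n : ℝ)⁻¹ • ∑ l ∈ Finset.range n, K.vecTerm 𝓙 h (z l)

/-- The expected operator `C`, where the samples have law `P`. -/
def popOp (𝓘 : Finset (Multiset (Fin d))) (h : Multiset (Fin d) → Z → ℝ) (P : Measure Z) :
    K.NativeSpace →L[ℝ] K.NativeSpace :=
  ∫ z, K.opTerm 𝓘 h z ∂P

/-- The expected element `g`, where the samples have law `Q`. -/
def popVec (𝓙 : Finset (Multiset (Fin d))) (h : Multiset (Fin d) → Z → ℝ) (Q : Measure Z) :
    K.NativeSpace :=
  ∫ z, K.vecTerm 𝓙 h z ∂Q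

/-- The quadratic loss of the scaled function,
`L(ξ; f) = ½ ⟨f_ξ, C f_ξ⟩ - ⟨g, f_ξ⟩`. -/
def scaledLoss (C : K.NativeSpace →L[ℝ] K.NativeSpace) (g f : K.NativeSpace)
    (ξ : Fin d → ℝ) : ℝ :=
  1 / 2 * inner ℝ (K.scale ξ f) (C (K.scale ξ f)) - inner ℝ g (K.scale ξ f)

/-- The restriction of the scaled loss to the `i`-th coordinate line through `ξ`. -/
def lossLine (C : K.NativeSpace →L[ℝ] K.NativeSpace) (g f : K.NativeSpace)
    (ξ : Fin d → ℝ) (i : Fin d) (t : ℝ) : ℝ :=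
  K.scaledLoss C g f (Function.update ξ i t)

/-- The derivative `∂L(ξ; f)/∂ξ_i` for `ξ ∈ [0,1]^d` (one-sided when `ξ_i` is `0` or `1`). -/
def lossDeriv (C : K.NativeSpace →L[ℝ] K.NativeSpace) (g f : K.NativeSpace)
    (ξ : Fin d → ℝ) (i : Fin d) : ℝ :=
  derivWithin (K.lossLine C g f ξ i) (Set.Icc 0 1) (ξ i)

/-- `sup_{ξ ∈ [0,1]^d} |∂L₁(ξ; f₁)/∂ξ_i - ∂L₂(ξ; f₂)/∂ξ_i|`, for the losses `L₁`, `L₂` given by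
`(C₁, g₁)` and `(C₂, g₂)`. -/
def supLossDerivDiff (C₁ C₂ : K.NativeSpace →L[ℝ] K.NativeSpace)
    (g₁ g₂ f₁ f₂ : K.NativeSpace) (i : Fin d) : ℝ≥0∞ :=
  ⨆ ξ ∈ Set.Icc (0 : Fin d → ℝ) 1,
    ENNReal.ofReal |K.lossDeriv C₁ g₁ f₁ ξ i - K.lossDeriv C₂ g₂ f₂ ξ i|

end PSWeights

/-- `X_m = O_P(r_m)` as `m → ∞`, for `[0,∞]`-valued `X_m` and deterministic rates `r_m`. -/
def IsBigOP {Ω : Type*} [MeasurableSpace Ω] (μ : Measure Ω) (X : ℕ → Ω → ℝ≥0∞) (r : ℕ → ℝ) :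
    Prop :=
  ∀ ε : ℝ, 0 < ε → ∃ M : ℝ, 0 < M ∧
    ∀ᶠ m in atTop, μ {ω | ENNReal.ofReal (M * r m) < X m ω} ≤ ENNReal.ofReal ε

end

/-!
The difficulty is that the scaling operators `f ↦ f_ξ` are not differentiable in `ξ` in the norm of
the native space at the boundary of `[0,1]^d`: the factors `α_i` that a derivative produces are
unbounded. Since `Z` lies in a cube of radius smaller than some `ρ < 1`, this is repaired by the
dilation `D : f ↦ f(ρ ·)`, a self-adjoint diagonal operator. On the one hand each derivative
`∂_I k(z,·)` with `z ∈ Z` is `D u_I(z)`, with `u_I(z)` bounded and continuous in `z`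
(`PSWeights.dil_undilKernelDeriv`); on the other hand `D f_ξ` has the coordinates of `f` multiplied
by `(ρ ξ)^α`, and all derivatives of these multipliers in `ξ ∈ [0,1]^d` are bounded uniformly in `α`
(`exists_bound_monoDeriv`). Moving `D` from the kernel side to the function side of the inner
products, a loss becomes `½ ⟨D f_ξ ⊗ D f_ξ, c⟩ - ⟨v, D f_ξ⟩`, where `c` is the average or the mean
of `∑ h_I u_I ⊗ u_I` in the Hilbert space tensor product, and `v` that of `∑ h'_J u_J`
(`PSWeights.OpRep`, `PSWeights.VecRep`). So its partial derivatives exist, are locally Lipschitz in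
`f` and are Lipschitz in `(c, v)`, uniformly in `ξ`
(`PSWeights.exists_supLossDerivDiff_le_of_norm_sub`, `PSWeights.exists_supLossDerivDiff_le_of_rep`).

Part (a) then only needs that convergence in probability has a rate, and that this rate can be
chosen as a non-increasing function of the sample size (`exists_rate_of_tendstoInMeasure`). Part (b)
is the second moment bound for averages of bounded independent random elements of a Hilbert space
(`integral_norm_sq_avg_sub_le`); using it for `c` in the tensor product, rather than for the
operator norm, is what makes it applicable. It gives the rate `1 / √s`, which is at most
`√(log s / s)` for `s ≥ 3`.
-/

noncomputable section

/-! ### Derivatives of monomials -/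

/-- The derivative `∂^γ x^α` of the monomial `x^α`, for multi-indices `γ` and `α`. It vanishes
unless `γ ≤ α`, because then a falling factorial is zero. -/
def monoDeriv {d : ℕ} (γ α : Fin d → ℕ) (x : Fin d → ℝ) : ℝ :=
  ∏ j, ((α j).descFactorial (γ j) : ℝ) * x j ^ (α j - γ j)

theorem monoDeriv_zero {d : ℕ} (α : Fin d → ℕ) (x : Fin d → ℝ) :
    monoDeriv 0 α x = mpow x α := by
  simp [monoDeriv, mpow]

theorem mem_openCube_iff_norm {d : ℕ} {x : Fin d → ℝ} : x ∈ openCube d ↔ ‖x‖ < 1 := by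
  rw [pi_norm_lt_iff one_pos]
  exact forall_congr' fun i => by rw [Real.norm_eq_abs, abs_lt]; rfl

theorem exists_bound_descFactorial_mul_pow (k : ℕ) {r : ℝ} (hr : r < 1) :
    ∃ B : ℝ, 0 ≤ B ∧ ∀ (n : ℕ) (t : ℝ), |t| ≤ r →
      |(n.descFactorial k : ℝ) * t ^ (n - k)| ≤ B := by
  -- enlarging the radius makes it positive, so that it can be divided by
  set q := max r (1 / 2) with hq
  have hq0 : 0 < q := lt_of_lt_of_le (by norm_num) (le_max_right _ _)
  have hq1 : q < 1 := max_lt hr (by norm_num)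
  have ht := tendsto_pow_const_mul_const_pow_of_abs_lt_one k (r := q) (by rwa [abs_of_pos hq0])
  obtain ⟨B, hB⟩ := ht.bddAbove_range
  have hB' : ∀ n : ℕ, (n : ℝ) ^ k * q ^ n ≤ B := fun n => hB ⟨n, rfl⟩
  have hB0 : 0 ≤ B := le_trans (by positivity) (hB' 0)
  refine ⟨B / q ^ k, by positivity, fun n t htr => ?_⟩
  rcases lt_or_ge n k with hnk | hnk
  · rw [Nat.descFactorial_of_lt hnk]
    simpa using (by positivity : 0 ≤ B / q ^ k)
  · rw [le_div_iff₀ (by positivity), abs_mul, abs_pow, Nat.abs_cast]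
    calc (n.descFactorial k : ℝ) * |t| ^ (n - k) * q ^ k
        ≤ (n : ℝ) ^ k * q ^ (n - k) * q ^ k := by
          have h1 : (n.descFactorial k : ℝ) ≤ (n : ℝ) ^ k := by
            exact_mod_cast Nat.descFactorial_le_pow n k
          have h2 : |t| ≤ q := htr.trans (le_max_left _ _)
          gcongr
      _ = (n : ℝ) ^ k * q ^ n := by rw [mul_assoc, ← pow_add, Nat.sub_add_cancel hnk]
      _ ≤ B := hB' n

theorem exists_bound_monoDeriv {d : ℕ} (γ : Fin d → ℕ) {r : ℝ} (hr : r < 1) :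
    ∃ B : ℝ, 0 ≤ B ∧ ∀ (α : Fin d → ℕ) (x : Fin d → ℝ), ‖x‖ ≤ r → |monoDeriv γ α x| ≤ B := by
  choose B hB0 hB using fun j => exists_bound_descFactorial_mul_pow (γ j) hr
  refine ⟨∏ j, B j, Finset.prod_nonneg fun j _ => hB0 j, fun α x hx => ?_⟩
  rw [monoDeriv, Finset.abs_prod]
  exact Finset.prod_le_prod (fun j _ => abs_nonneg _)
    fun j _ => hB j _ _ ((norm_le_pi_norm x j).trans hx)

theorem continuous_monoDeriv {d : ℕ} (γ α : Fin d → ℕ) : Continuous (monoDeriv γ α) := by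
  unfold monoDeriv
  fun_prop

theorem hasDerivAt_monoDeriv {d : ℕ} (γ α : Fin d → ℕ) (x : Fin d → ℝ) (i : Fin d) (t : ℝ) :
    HasDerivAt (fun t => monoDeriv γ α (Function.update x i t))
      (monoDeriv (γ + Pi.single i 1) α (Function.update x i t)) t := by
  have key : ∀ (γ' : Fin d → ℕ), (∀ j, j ≠ i → γ' j = γ j) → ∀ t,
      monoDeriv γ' α (Function.update x i t) =
      (((α i).descFactorial (γ' i) : ℝ) * t ^ (α i - γ' i)) *
      ∏ j ∈ Finset.univ.erase i, ((α j).descFactorial (γ j) : ℝ) * x j ^ (α j - γ j) := by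
    intro γ' hγ' t
    rw [monoDeriv, ← Finset.mul_prod_erase _ _ (Finset.mem_univ i), Function.update_self]
    congr 1
    refine Finset.prod_congr rfl fun j hj => ?_
    have hj' := Finset.ne_of_mem_erase hj
    rw [Function.update_of_ne hj', hγ' j hj']
  rw [key (γ + Pi.single i 1) (fun j hj => by simp [hj])]
  simp_rw [key γ (fun _ _ => rfl)]
  refine HasDerivAt.mul_const ?_ _
  have h := (hasDerivAt_pow (α i - γ i) t).const_mul ((α i).descFactorial (γ i) : ℝ)
  convert h using 1
  simp only [Pi.add_apply, Pi.single_eq_same, Nat.descFactorial_succ, Nat.cast_mul, Nat.sub_sub]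
  ring

/-- The first order Taylor remainder of the partial derivatives of monomials is bounded uniformly
in the exponent, on boxes inside the open cube. -/
theorem abs_monoDeriv_taylor_le {d : ℕ} (γ α : Fin d → ℕ) (x : Fin d → ℝ) (i : Fin d) {r B : ℝ}
    (hB : ∀ x : Fin d → ℝ, ‖x‖ ≤ r → |monoDeriv (γ + Pi.single i 1 + Pi.single i 1) α x| ≤ B)
    {s t : ℝ} (hs : ‖Function.update x i s‖ ≤ r) (ht : ‖Function.update x i t‖ ≤ r) :
    |monoDeriv γ α (Function.update x i t) - monoDeriv γ α (Function.update x i s)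
      - (t - s) * monoDeriv (γ + Pi.single i 1) α (Function.update x i s)| ≤ B * (t - s) ^ 2 := by
  have hr : 0 ≤ r := (norm_nonneg _).trans hs
  have hbox : ∀ τ ∈ Set.uIcc s t, ‖Function.update x i τ‖ ≤ r := by
    intro τ hτ
    rw [pi_norm_le_iff_of_nonneg hr] at hs ht ⊢
    intro j
    rcases eq_or_ne j i with rfl | hj
    · have h1 := hs j
      have h2 := ht j
      rw [Function.update_self, Real.norm_eq_abs, abs_le] at h1 h2 ⊢
      rcases Set.mem_uIcc.1 hτ with h | h <;> constructor <;> linarith [h.1, h.2]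
    · have h1 := hs j
      rwa [Function.update_of_ne hj] at h1 ⊢
  have hder1 : ∀ τ ∈ Set.uIcc s t,
      |monoDeriv (γ + Pi.single i 1) α (Function.update x i τ)
        - monoDeriv (γ + Pi.single i 1) α (Function.update x i s)| ≤ B * |t - s| := by
    intro τ hτ
    have h := (convex_uIcc s t).norm_image_sub_le_of_norm_hasDerivWithin_le
      (fun τ _ => (hasDerivAt_monoDeriv (γ + Pi.single i 1) α x i τ).hasDerivWithinAt)
      (fun τ hτ => hB _ (hbox τ hτ)) Set.left_mem_uIcc hτ
    refine h.trans ?_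
    have hB0 : 0 ≤ B := (abs_nonneg _).trans (hB _ hs)
    exact mul_le_mul_of_nonneg_left (Set.abs_sub_left_of_mem_uIcc hτ) hB0
  have hder2 : ∀ τ, HasDerivAt (fun τ => monoDeriv γ α (Function.update x i τ)
      - τ * monoDeriv (γ + Pi.single i 1) α (Function.update x i s))
      (monoDeriv (γ + Pi.single i 1) α (Function.update x i τ)
        - monoDeriv (γ + Pi.single i 1) α (Function.update x i s)) τ := fun τ => by
    have h := (hasDerivAt_monoDeriv γ α x i τ).sub ((hasDerivAt_id τ).mul_const
      (monoDeriv (γ + Pi.single i 1) α (Function.update x i s)))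
    rw [one_mul] at h
    exact h
  have h := (convex_uIcc s t).norm_image_sub_le_of_norm_hasDerivWithin_le
    (fun τ _ => (hder2 τ).hasDerivWithinAt) hder1 Set.left_mem_uIcc Set.right_mem_uIcc
  rw [Real.norm_eq_abs, Real.norm_eq_abs, mul_assoc, abs_mul_abs_self, ← pow_two] at h
  convert h using 2
  ring

/-- Homogeneity of `∂^γ x^α`, of degree `|α| - |γ|`. -/
theorem monoDeriv_smul {d : ℕ} (γ α : Fin d → ℕ) (ρ : ℝ) (x : Fin d → ℝ) :
    ρ ^ (∑ j, γ j) * monoDeriv γ α (ρ • x) = mpow (fun _ => ρ) α * monoDeriv γ α x := by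
  rw [mpow, monoDeriv, monoDeriv, ← Finset.prod_pow_eq_pow_sum, ← Finset.prod_mul_distrib,
    ← Finset.prod_mul_distrib]
  refine Finset.prod_congr rfl fun j _ => ?_
  rcases lt_or_ge (α j) (γ j) with h | h
  · simp [Nat.descFactorial_of_lt h]
  · rw [Pi.smul_apply, smul_eq_mul, mul_pow]
    rw [show ρ ^ α j = ρ ^ (α j - γ j) * ρ ^ γ j by rw [← pow_add, Nat.sub_add_cancel h]]
    ring

/-- A compact subset of the open cube lies in a smaller closed cube. -/
theorem exists_norm_le_of_isCompact {d : ℕ} {Z : Set (Fin d → ℝ)} (hZc : IsCompact Z)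
    (hZ : Z ⊆ openCube d) : ∃ r : ℝ, 0 < r ∧ r < 1 ∧ ∀ z ∈ Z, ‖z‖ ≤ r := by
  rcases Z.eq_empty_or_nonempty with rfl | hne
  · exact ⟨1 / 2, by norm_num, by norm_num, by simp⟩
  · obtain ⟨z₀, hz₀, hmax⟩ := hZc.exists_isMaxOn hne continuous_norm.continuousOn
    exact ⟨max ‖z₀‖ (1 / 2), by positivity,
      max_lt (mem_openCube_iff_norm.1 (hZ hz₀)) (by norm_num),
      fun z hz => (hmax hz).trans (le_max_left _ _)⟩

/-! ### Diagonal operators on the native space -/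

namespace PSWeights

variable {d : ℕ} (K : PSWeights d)

@[simp] theorem coord_add (f g : K.NativeSpace) (α : K.Supp) :
    K.coord (f + g) α = K.coord f α + K.coord g α := rfl

@[simp] theorem coord_sub (f g : K.NativeSpace) (α : K.Supp) :
    K.coord (f - g) α = K.coord f α - K.coord g α := rfl

@[simp] theorem coord_smul (c : ℝ) (f : K.NativeSpace) (α : K.Supp) :
    K.coord (c • f) α = c * K.coord f α := rfl

theorem hasSum_norm_sq (f : K.NativeSpace) : HasSum (fun α => K.coord f α ^ 2) (‖f‖ ^ 2) := by
  simpa [pow_two, real_inner_self_eq_norm_mul_norm] using K.hasSum_inner f f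

theorem norm_le_of_abs_coord_le {f g : K.NativeSpace} {B : ℝ} (hB : 0 ≤ B)
    (h : ∀ α, |K.coord f α| ≤ B * |K.coord g α|) : ‖f‖ ≤ B * ‖g‖ := by
  refine abs_le_of_sq_le_sq' ?_ (by positivity) |>.2
  rw [mul_pow]
  refine hasSum_le (fun α => ?_) (K.hasSum_norm_sq f) ((K.hasSum_norm_sq g).mul_left (B ^ 2))
  rw [← mul_pow, ← sq_abs (K.coord f α), ← sq_abs (B * _), abs_mul, abs_of_nonneg hB]
  gcongr
  exact h α

/-- The diagonal operator with bounded multipliers `a α`. -/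
def diag (a : K.Supp → ℝ) (h : ∃ B : ℝ, 0 ≤ B ∧ ∀ α, |a α| ≤ B) :
    K.NativeSpace →L[ℝ] K.NativeSpace :=
  LinearMap.mkContinuousOfExistsBound
    { toFun := fun f => K.ofCoord (fun α => a α * K.coord f α) (by
        obtain ⟨B, hB0, hB⟩ := h
        refine Summable.of_nonneg_of_le (fun _ => sq_nonneg _) (fun α => ?_)
          ((K.summable_coord_sq f).mul_left (B ^ 2))
        rw [mul_pow]
        exact mul_le_mul_of_nonneg_right (sq_le_sq.2 ((hB α).trans (le_abs_self B)))
          (sq_nonneg _))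
      map_add' := fun f g => K.coord_ext fun α => by simp [mul_add]
      map_smul' := fun c f => K.coord_ext fun α => by simp; ring }
    (by
      obtain ⟨B, hB0, hB⟩ := h
      refine ⟨B, fun f => K.norm_le_of_abs_coord_le hB0 fun α => ?_⟩
      simp only [LinearMap.coe_mk, AddHom.coe_mk, coord_ofCoord, abs_mul]
      exact mul_le_mul_of_nonneg_right (hB α) (abs_nonneg _))

open Classical in
/-- The diagonal operator `f ↦ (∂^γ x^α · a_α)_α` on the coordinates `a_α` of `f`, for `x` in the
open cube, where its multipliers are bounded (and `0` for other `x`). In terms of functions,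
`monoOp 0 x f` is `y ↦ f (x ∘ y)`, and `monoOp γ x f` is its derivative `∂^γ` in `x`. -/
def monoOp (γ : Fin d → ℕ) (x : Fin d → ℝ) : K.NativeSpace →L[ℝ] K.NativeSpace :=
  if hx : x ∈ openCube d then K.diag (fun α => monoDeriv γ α.1 x) (by
    obtain ⟨B, hB0, hB⟩ := exists_bound_monoDeriv γ (mem_openCube_iff_norm.1 hx)
    exact ⟨B, hB0, fun α => hB _ _ le_rfl⟩) else 0

theorem coord_monoOp (γ : Fin d → ℕ) {x : Fin d → ℝ} (hx : x ∈ openCube d) (f : K.NativeSpace)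
    (α : K.Supp) : K.coord (K.monoOp γ x f) α = monoDeriv γ α.1 x * K.coord f α := by
  rw [monoOp, dif_pos hx]
  rfl

theorem inner_monoOp_right (γ : Fin d → ℕ) (x : Fin d → ℝ) (f g : K.NativeSpace) :
    inner ℝ f (K.monoOp γ x g) = inner ℝ (K.monoOp γ x f) g := by
  by_cases hx : x ∈ openCube d
  · rw [← (K.hasSum_inner _ _).tsum_eq, ← (K.hasSum_inner _ _).tsum_eq]
    refine tsum_congr fun α => ?_
    rw [K.coord_monoOp γ hx, K.coord_monoOp γ hx]
    ring
  · simp [monoOp, hx]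

theorem exists_bound_monoOp (γ : Fin d → ℕ) {r : ℝ} (hr : r < 1) :
    ∃ B : ℝ, 0 ≤ B ∧ ∀ (x : Fin d → ℝ) (f : K.NativeSpace), ‖x‖ ≤ r →
      ‖K.monoOp γ x f‖ ≤ B * ‖f‖ := by
  obtain ⟨B, hB0, hB⟩ := exists_bound_monoDeriv γ hr
  refine ⟨B, hB0, fun x f hx => K.norm_le_of_abs_coord_le hB0 fun α => ?_⟩
  rw [K.coord_monoOp γ (mem_openCube_iff_norm.2 (hx.trans_lt hr)), abs_mul]
  exact mul_le_mul_of_nonneg_right (hB _ _ hx) (abs_nonneg _)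

/-- Differentiation under the sum: the uniform Taylor remainder of the monomials passes to the
norm of the native space. -/
theorem hasDerivAt_monoOp (γ : Fin d → ℕ) (f : K.NativeSpace) {x : Fin d → ℝ}
    (hx : x ∈ openCube d) (i : Fin d) :
    HasDerivAt (fun t => K.monoOp γ (Function.update x i t) f)
      (K.monoOp (γ + Pi.single i 1) x f) (x i) := by
  obtain ⟨r, hxr, hr⟩ := exists_between (mem_openCube_iff_norm.1 hx)
  obtain ⟨B, hB0, hB⟩ := exists_bound_monoDeriv (γ + Pi.single i 1 + Pi.single i 1) hr
  have hnear : ∀ᶠ t in 𝓝 (x i), ‖Function.update x i t‖ < r := by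
    have hc : ContinuousAt (fun t => ‖Function.update x i t‖) (x i) := by fun_prop
    refine hc.eventually_lt_const ?_
    simpa using hxr
  rw [hasDerivAt_iff_isLittleO]
  refine Asymptotics.IsBigO.trans_isLittleO (g := fun t => ‖t - x i‖ ^ 2) ?_
    (Asymptotics.isLittleO_pow_sub_sub (x i) one_lt_two)
  refine Asymptotics.IsBigO.of_bound (B * ‖f‖) ?_
  filter_upwards [hnear] with t ht
  have hmem : Function.update x i t ∈ openCube d := mem_openCube_iff_norm.2 (ht.trans hr)
  rw [Function.update_eq_self, Real.norm_eq_abs, Real.norm_eq_abs, sq_abs, abs_pow, sq_abs,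
    mul_right_comm]
  refine K.norm_le_of_abs_coord_le (by positivity) fun α => ?_
  have h := abs_monoDeriv_taylor_le γ α.1 x i (hB α.1) (s := x i) (t := t)
    (by rw [Function.update_eq_self]; exact hxr.le) ht.le
  rw [Function.update_eq_self] at h
  rw [coord_sub, coord_sub, coord_smul, K.coord_monoOp γ hmem, K.coord_monoOp γ hx,
    K.coord_monoOp _ hx, ← mul_assoc, ← sub_mul, ← sub_mul, abs_mul]
  exact mul_le_mul_of_nonneg_right h (abs_nonneg _)

theorem continuousOn_monoOp (γ : Fin d → ℕ) (f : K.NativeSpace) :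
    ContinuousOn (fun x => K.monoOp γ x f) (openCube d) := by
  intro x₀ hx₀
  refine ContinuousAt.continuousWithinAt ?_
  obtain ⟨r, hxr, hr⟩ := exists_between (mem_openCube_iff_norm.1 hx₀)
  obtain ⟨B, hB0, hB⟩ := exists_bound_monoDeriv γ hr
  have hnear : ∀ᶠ x : Fin d → ℝ in 𝓝 x₀, ‖x‖ < r :=
    continuous_norm.continuousAt.eventually_lt_const hxr
  have hlim : Tendsto (fun x => ∑' α : K.Supp,
      ((monoDeriv γ α.1 x - monoDeriv γ α.1 x₀) * K.coord f α) ^ 2) (𝓝 x₀)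
      (𝓝 (∑' _ : K.Supp, 0)) := by
    refine tendsto_tsum_of_dominated_convergence (bound := fun α => (2 * B) ^ 2 * K.coord f α ^ 2)
      ((K.summable_coord_sq f).mul_left _) (fun α => ?_) ?_
    · have h : Continuous fun x => ((monoDeriv γ α.1 x - monoDeriv γ α.1 x₀) * K.coord f α) ^ 2 := by
        have := continuous_monoDeriv γ α.1
        fun_prop
      simpa using h.tendsto x₀
    · filter_upwards [hnear] with x hx α
      rw [Real.norm_eq_abs, abs_pow, abs_mul, mul_pow, sq_abs (K.coord f α)]
      have h1 := hB α.1 x hx.le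
      have h2 := hB α.1 x₀ hxr.le
      have h3 := abs_sub (monoDeriv γ α.1 x) (monoDeriv γ α.1 x₀)
      gcongr
      linarith
  rw [tsum_zero] at hlim
  rw [ContinuousAt, tendsto_iff_norm_sub_tendsto_zero]
  have hsqrt := hlim.sqrt
  rw [Real.sqrt_zero] at hsqrt
  refine hsqrt.congr' ?_
  filter_upwards [hnear] with x hx
  have hx' : x ∈ openCube d := mem_openCube_iff_norm.2 (hx.trans hr)
  rw [Real.sqrt_eq_iff_mul_self_eq (tsum_nonneg fun _ => sq_nonneg _) (norm_nonneg _), ← pow_two,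
    ← (K.hasSum_norm_sq _).tsum_eq]
  refine tsum_congr fun α => ?_
  rw [coord_sub, K.coord_monoOp γ hx', K.coord_monoOp γ hx₀, sub_mul]

/-! ### Derivatives of the kernel -/

theorem foldr_partialD_eq {E : Type*} [NormedAddCommGroup E] [NormedSpace ℝ E]
    (A : K.NativeSpace →L[ℝ] E) (f : K.NativeSpace) {F : (Fin d → ℝ) → E}
    (hF : ∀ z ∈ openCube d, F z = A (K.monoOp 0 z f)) (L : List (Fin d)) :
    ∀ z ∈ openCube d, L.foldr partialD F z = A (K.monoOp (fun i => L.count i) z f) := by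
  induction L with
  | nil => exact hF
  | cons i L ih =>
    intro z hz
    rw [List.foldr_cons, partialD]
    have hopen : openCube d ∈ 𝓝 z := by
      have : openCube d = Metric.ball 0 1 := by ext x; simp [mem_openCube_iff_norm]
      rw [this] at hz ⊢
      exact Metric.isOpen_ball.mem_nhds hz
    have hγ : (fun j => (i :: L).count j) = (fun j => L.count j) + Pi.single i 1 := by
      funext j
      simp only [List.count_cons, Pi.add_apply, Pi.single_apply, beq_iff_eq]
      congr 1
      exact if_congr eq_comm rfl rfl
    have heq : L.foldr partialD F =ᶠ[𝓝 z] A ∘ fun z => K.monoOp (fun i => L.count i) z f :=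
      Filter.eventually_of_mem hopen ih
    rw [heq.lineDeriv_eq, hγ]
    refine HasLineDerivAt.lineDeriv ?_
    rw [HasLineDerivAt]
    have h := A.hasFDerivAt.comp_hasDerivAt (z i)
      (K.hasDerivAt_monoOp (fun i => L.count i) f hz i)
    have hupd : ∀ t : ℝ, z + t • Pi.single i 1 = Function.update z i (z i + t) := by
      intro t
      funext j
      rcases eq_or_ne j i with rfl | hj
      · simp
      · simp [hj]
    simp_rw [hupd]
    rw [← add_zero (z i)] at h
    exact HasDerivAt.comp_const_add (z i) 0 h

/-- The element with coordinates `√w_α / α!`; formally it is `k(1,·)`, with `1` the corner of the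
cube. -/
def cornerFeature : K.NativeSpace :=
  K.ofCoord (fun α => √(K.w α.1) / mfact α.1) (by
    refine (K.summable.comp_injective
      (Subtype.val_injective (p := fun α => 0 < K.w α))).congr fun α => ?_
    rw [div_pow, Real.sq_sqrt α.2.le]
    rfl)

theorem feature_eq_monoOp {z : Fin d → ℝ} (hz : z ∈ openCube d) :
    K.feature z = K.monoOp 0 z K.cornerFeature := by
  refine K.coord_ext fun α => ?_
  rw [K.coord_monoOp 0 hz, monoDeriv_zero, feature, dif_pos hz, coord_ofCoord, cornerFeature,
    coord_ofCoord, mul_comm]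

theorem kernelDeriv_eq (I : Multiset (Fin d)) {z : Fin d → ℝ} (hz : z ∈ openCube d) :
    K.kernelDeriv I z = K.monoOp (fun i => I.count i) z K.cornerFeature := by
  have h := K.foldr_partialD_eq (ContinuousLinearMap.id ℝ _) K.cornerFeature
    (F := K.feature) (fun z hz => K.feature_eq_monoOp hz) I.toList z hz
  have hc : (fun i => I.toList.count i) = fun i => I.count i := by
    funext i
    rw [← Multiset.coe_count, Multiset.coe_toList]
  rw [hc] at h
  exact h

theorem kernelDeriv_apply (I : Multiset (Fin d)) {z : Fin d → ℝ} (hz : z ∈ openCube d)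
    (u : openCube d) :
    K.kernelDeriv I z u = partialMulti I (fun v => K.kernel v u) z := by
  have h := K.foldr_partialD_eq (innerSL ℝ (K.feature u)) K.cornerFeature
    (F := fun v => K.kernel v u) (fun v hv => ?_) I.toList z hz
  · rw [partialMulti, h, ← K.inner_feature, kernelDeriv, partialMulti,
      K.foldr_partialD_eq (ContinuousLinearMap.id ℝ _) K.cornerFeature
        (F := K.feature) (fun z hz => K.feature_eq_monoOp hz) I.toList z hz]
    rfl
  · rw [← K.feature_eq_monoOp hv, innerSL_apply_apply, K.inner_feature,
      K.feature_apply ⟨v, hv⟩ u]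

end PSWeights

/-! ### The Hilbert tensor product -/

open scoped TensorProduct in
/-- The Hilbert space tensor product of `E` with itself. It represents the Hilbert-Schmidt
operators on `E` by vectors. -/
abbrev HilbertTensor (E : Type*) [NormedAddCommGroup E] [InnerProductSpace ℝ E] : Type _ :=
  UniformSpace.Completion (E ⊗[ℝ] E)

/-- The elementary tensors `a ⊗ b` of `HilbertTensor E`, as a continuous bilinear map. -/
def tensorL (E : Type*) [NormedAddCommGroup E] [InnerProductSpace ℝ E] :
    E →L[ℝ] E →L[ℝ] HilbertTensor E :=
  (ContinuousLinearMap.compL ℝ _ _ _ UniformSpace.Completion.toComplL) ∘L TensorProduct.mkL ℝ E E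

section Tensor

variable {E : Type*} [NormedAddCommGroup E] [InnerProductSpace ℝ E]

theorem inner_tensorL (a b a' b' : E) :
    inner ℝ (tensorL E a b) (tensorL E a' b') = inner ℝ a a' * inner ℝ b b' := by
  change inner ℝ ((TensorProduct.tmul ℝ a b : _) : HilbertTensor E)
    ((TensorProduct.tmul ℝ a' b' : _) : HilbertTensor E) = _
  rw [UniformSpace.Completion.inner_coe, TensorProduct.inner_tmul]

theorem norm_tensorL (a b : E) : ‖tensorL E a b‖ = ‖a‖ * ‖b‖ := by
  change ‖((TensorProduct.tmul ℝ a b : _) : HilbertTensor E)‖ = _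
  rw [UniformSpace.Completion.norm_coe, TensorProduct.norm_tmul]

end Tensor

/-! ### Factorization of the losses through a contraction -/

theorem const_mem_openCube {d : ℕ} {ρ : ℝ} (hρ0 : 0 < ρ) (hρ1 : ρ < 1) :
    (fun _ => ρ) ∈ openCube d :=
  fun _ => ⟨by linarith, hρ1⟩

theorem norm_smul_le_of_mem_Icc {d : ℕ} {ρ : ℝ} (hρ0 : 0 < ρ) {ξ : Fin d → ℝ}
    (hξ : ξ ∈ Set.Icc (0 : Fin d → ℝ) 1) : ‖ρ • ξ‖ ≤ ρ := by
  rw [norm_smul, Real.norm_of_nonneg hρ0.le]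
  refine mul_le_of_le_one_right hρ0.le ((pi_norm_le_iff_of_nonneg zero_le_one).2 fun i => ?_)
  rw [Real.norm_of_nonneg (hξ.1 i)]
  exact hξ.2 i

namespace PSWeights

variable {d : ℕ} (K : PSWeights d)

/-- The dilation `f ↦ f(ρ ·)` of the native space by the factor `ρ < 1`. -/
abbrev dil (ρ : ℝ) : K.NativeSpace →L[ℝ] K.NativeSpace := K.monoOp 0 (fun _ => ρ)

/-- The preimage of `∂_I k(z,·)` under the dilation by `ρ`, for `‖z‖ < ρ`; it is
`ρ^{-|I|} ∂_I k(z/ρ,·)`. -/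
def undilKernelDeriv (ρ : ℝ) (I : Multiset (Fin d)) (z : Fin d → ℝ) : K.NativeSpace :=
  (ρ ^ ∑ j, I.count j)⁻¹ • K.monoOp (fun i => I.count i) (ρ⁻¹ • z) K.cornerFeature

theorem inv_smul_mem_openCube {ρ : ℝ} (hρ0 : 0 < ρ) {z : Fin d → ℝ} (hz : ‖z‖ < ρ) :
    ρ⁻¹ • z ∈ openCube d := by
  rw [mem_openCube_iff_norm, norm_smul, norm_inv, Real.norm_of_nonneg hρ0.le, inv_mul_lt_one₀ hρ0]
  exact hz

theorem dil_undilKernelDeriv {ρ : ℝ} (hρ0 : 0 < ρ) (hρ1 : ρ < 1) (I : Multiset (Fin d))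
    {z : Fin d → ℝ} (hz : ‖z‖ < ρ) :
    K.dil ρ (K.undilKernelDeriv ρ I z) = K.kernelDeriv I z := by
  have hz1 : z ∈ openCube d := mem_openCube_iff_norm.2 (hz.trans hρ1)
  refine K.coord_ext fun α => ?_
  rw [K.coord_monoOp 0 (const_mem_openCube hρ0 hρ1), undilKernelDeriv, coord_smul,
    K.coord_monoOp _ (inv_smul_mem_openCube hρ0 hz), K.kernelDeriv_eq I hz1,
    K.coord_monoOp _ hz1, monoDeriv_zero]
  have h := monoDeriv_smul (fun i => I.count i) α.1 ρ (ρ⁻¹ • z)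
  rw [smul_inv_smul₀ hρ0.ne'] at h
  rw [← mul_left_cancel_iff_of_pos (pow_pos hρ0 (∑ j, I.count j)), ← mul_assoc _ (monoDeriv _ _ z),
    h]
  field_simp

theorem dil_scale {ρ : ℝ} (hρ0 : 0 < ρ) (hρ1 : ρ < 1) {ξ : Fin d → ℝ}
    (hξ : ξ ∈ Set.Icc (0 : Fin d → ℝ) 1) (f : K.NativeSpace) :
    K.dil ρ (K.scale ξ f) = K.monoOp 0 (ρ • ξ) f := by
  have hξ' : ∀ i, ξ i ∈ Set.Icc (0 : ℝ) 1 := fun i => ⟨hξ.1 i, hξ.2 i⟩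
  refine K.coord_ext fun α => ?_
  rw [K.coord_monoOp 0 (const_mem_openCube hρ0 hρ1), scale, dif_pos hξ', coord_ofCoord,
    K.coord_monoOp 0 (mem_openCube_iff_norm.2 ((norm_smul_le_of_mem_Icc hρ0 hξ).trans_lt hρ1)),
    monoDeriv_zero, monoDeriv_zero, ← mul_assoc]
  simp [mpow, mul_pow, Finset.prod_mul_distrib]

/-- The operator `C` factors through the dilation by `ρ` and the Hilbert-Schmidt operator that the
tensor `c` represents. -/
def OpRep (ρ : ℝ) (C : K.NativeSpace →L[ℝ] K.NativeSpace) (c : HilbertTensor K.NativeSpace) :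
    Prop :=
  ∀ a b, inner ℝ a (C b) = inner ℝ (tensorL _ (K.dil ρ a) (K.dil ρ b)) c

/-- The element `g` is the image of `v` under the (self-adjoint) dilation by `ρ`, stated weakly. -/
def VecRep (ρ : ℝ) (g v : K.NativeSpace) : Prop :=
  ∀ a, inner ℝ g a = inner ℝ v (K.dil ρ a)

/-- The derivative in `t` of the dilated scaled function `(f_ξ)(ρ ·)` along the `i`-th coordinate
line. -/
theorem hasDerivAt_monoOp_smul_update {ρ : ℝ} (hρ0 : 0 < ρ) (hρ1 : ρ < 1) (f : K.NativeSpace)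
    {ξ : Fin d → ℝ} (hξ : ξ ∈ Set.Icc (0 : Fin d → ℝ) 1) (i : Fin d) :
    HasDerivAt (fun t => K.monoOp 0 (ρ • Function.update ξ i t) f)
      (ρ • K.monoOp (Pi.single i 1) (ρ • ξ) f) (ξ i) := by
  have h := K.hasDerivAt_monoOp 0 f
    (mem_openCube_iff_norm.2 ((norm_smul_le_of_mem_Icc hρ0 hξ).trans_lt hρ1)) i
  rw [zero_add] at h
  have h2 : HasDerivAt (fun t : ℝ => ρ * t) ρ (ξ i) := by
    simpa using (hasDerivAt_id (ξ i)).const_mul ρ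
  have h3 := HasDerivAt.scomp (ξ i) h h2
  refine h3.congr_of_eventuallyEq (Eventually.of_forall fun t => ?_)
  change _ = K.monoOp 0 (Function.update (ρ • ξ) i (ρ * t)) f
  rw [← smul_eq_mul, Function.update_smul]

/-- The derivative of the scaled loss in terms of a representation `(c, v)` of `(C, g)`: it is
linear in `(c, v)`. -/
def repLossDeriv (ρ : ℝ) (c : HilbertTensor K.NativeSpace) (v f : K.NativeSpace) (ξ : Fin d → ℝ)
    (i : Fin d) : ℝ :=
  1 / 2 * inner ℝ (tensorL _ (K.monoOp 0 (ρ • ξ) f) (ρ • K.monoOp (Pi.single i 1) (ρ • ξ) f)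
      + tensorL _ (ρ • K.monoOp (Pi.single i 1) (ρ • ξ) f) (K.monoOp 0 (ρ • ξ) f)) c
    - inner ℝ v (ρ • K.monoOp (Pi.single i 1) (ρ • ξ) f)

variable {K}

theorem hasDerivWithinAt_lossLine {ρ : ℝ} (hρ0 : 0 < ρ) (hρ1 : ρ < 1)
    {C : K.NativeSpace →L[ℝ] K.NativeSpace} {c : HilbertTensor K.NativeSpace}
    (hC : K.OpRep ρ C c) {g v : K.NativeSpace} (hg : K.VecRep ρ g v) (f : K.NativeSpace)
    {ξ : Fin d → ℝ} (hξ : ξ ∈ Set.Icc (0 : Fin d → ℝ) 1) (i : Fin d) :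
    HasDerivWithinAt (K.lossLine C g f ξ i) (K.repLossDeriv ρ c v f ξ i) (Set.Icc 0 1) (ξ i) := by
  have hF := K.hasDerivAt_monoOp_smul_update hρ0 hρ1 f hξ i
  have hT := (tensorL K.NativeSpace).hasDerivAt_of_bilinear (fun _ => hF) (fun _ => hF)
  have h1 := (hT.inner ℝ (hasDerivAt_const (ξ i) c)).const_mul (1 / 2 : ℝ)
  have h2 := (hasDerivAt_const (ξ i) v).inner ℝ hF
  have h3 := (h1.sub h2).hasDerivWithinAt (s := Set.Icc (0 : ℝ) 1)
  rw [Function.update_eq_self, inner_zero_right, zero_add, inner_zero_left, add_zero] at h3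
  have heq : ∀ t ∈ Set.Icc (0 : ℝ) 1, K.lossLine C g f ξ i t =
      1 / 2 * inner ℝ (tensorL _ (K.monoOp 0 (ρ • Function.update ξ i t) f)
        (K.monoOp 0 (ρ • Function.update ξ i t) f)) c
      - inner ℝ v (K.monoOp 0 (ρ • Function.update ξ i t) f) := by
    intro t ht
    have hupd : Function.update ξ i t ∈ Set.Icc (0 : Fin d → ℝ) 1 := by
      constructor <;> intro j <;> rcases eq_or_ne j i with rfl | hj
      · simpa using ht.1
      · simpa [hj] using hξ.1 j
      · simpa using ht.2
      · simpa [hj] using hξ.2 j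
    rw [lossLine, scaledLoss, hC, hg, K.dil_scale hρ0 hρ1 hupd]
  exact h3.congr heq (heq _ ⟨hξ.1 i, hξ.2 i⟩)

theorem lossDeriv_eq {ρ : ℝ} (hρ0 : 0 < ρ) (hρ1 : ρ < 1)
    {C : K.NativeSpace →L[ℝ] K.NativeSpace} {c : HilbertTensor K.NativeSpace}
    (hC : K.OpRep ρ C c) {g v : K.NativeSpace} (hg : K.VecRep ρ g v) (f : K.NativeSpace)
    {ξ : Fin d → ℝ} (hξ : ξ ∈ Set.Icc (0 : Fin d → ℝ) 1) (i : Fin d) :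
    K.lossDeriv C g f ξ i = K.repLossDeriv ρ c v f ξ i :=
  (hasDerivWithinAt_lossLine hρ0 hρ1 hC hg f hξ i).derivWithin
    (uniqueDiffOn_Icc zero_lt_one _ ⟨hξ.1 i, hξ.2 i⟩)

variable (K)

theorem exists_bound_dilated {ρ : ℝ} (hρ0 : 0 < ρ) (hρ1 : ρ < 1) (i : Fin d) :
    ∃ A : ℝ, 0 ≤ A ∧ ∀ ξ ∈ Set.Icc (0 : Fin d → ℝ) 1, ∀ f : K.NativeSpace,
      ‖K.monoOp 0 (ρ • ξ) f‖ ≤ A * ‖f‖ ∧ ‖ρ • K.monoOp (Pi.single i 1) (ρ • ξ) f‖ ≤ A * ‖f‖ := by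
  obtain ⟨A, hA0, hA⟩ := K.exists_bound_monoOp 0 hρ1
  obtain ⟨A', hA'0, hA'⟩ := K.exists_bound_monoOp (Pi.single i 1) hρ1
  refine ⟨max A A', le_max_of_le_left hA0, fun ξ hξ f => ⟨?_, ?_⟩⟩
  · refine (hA _ f (norm_smul_le_of_mem_Icc hρ0 hξ)).trans ?_
    gcongr
    exact le_max_left _ _
  · rw [norm_smul, Real.norm_of_nonneg hρ0.le]
    refine (mul_le_of_le_one_left (norm_nonneg _) hρ1.le).trans
      ((hA' _ f (norm_smul_le_of_mem_Icc hρ0 hξ)).trans ?_)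
    gcongr
    exact le_max_right _ _

/-- The derivative of the scaled loss is Lipschitz in `(C, g)`, uniformly in `ξ`. -/
theorem exists_supLossDerivDiff_le_of_rep {ρ : ℝ} (hρ0 : 0 < ρ) (hρ1 : ρ < 1) (i : Fin d) :
    ∃ A : ℝ, 0 ≤ A ∧ ∀ (C₁ C₂ : K.NativeSpace →L[ℝ] K.NativeSpace)
      (c₁ c₂ : HilbertTensor K.NativeSpace) (g₁ g₂ v₁ v₂ f : K.NativeSpace),
      K.OpRep ρ C₁ c₁ → K.OpRep ρ C₂ c₂ → K.VecRep ρ g₁ v₁ → K.VecRep ρ g₂ v₂ →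
      K.supLossDerivDiff C₁ C₂ g₁ g₂ f f i ≤
        ENNReal.ofReal (A * (‖c₁ - c₂‖ * ‖f‖ ^ 2 + ‖v₁ - v₂‖ * ‖f‖)) := by
  obtain ⟨A, hA0, hA⟩ := K.exists_bound_dilated hρ0 hρ1 i
  refine ⟨A ^ 2 + A, by positivity, fun C₁ C₂ c₁ c₂ g₁ g₂ v₁ v₂ f hC₁ hC₂ hg₁ hg₂ => ?_⟩
  refine iSup₂_le fun ξ hξ => ENNReal.ofReal_le_ofReal ?_
  rw [lossDeriv_eq hρ0 hρ1 hC₁ hg₁ f hξ, lossDeriv_eq hρ0 hρ1 hC₂ hg₂ f hξ, repLossDeriv,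
    repLossDeriv]
  obtain ⟨h0, h1⟩ := hA ξ hξ f
  set F := K.monoOp 0 (ρ • ξ) f
  set G := ρ • K.monoOp (Pi.single i 1) (ρ • ξ) f
  have e : 1 / 2 * inner ℝ (tensorL _ F G + tensorL _ G F) c₁ - inner ℝ v₁ G
      - (1 / 2 * inner ℝ (tensorL _ F G + tensorL _ G F) c₂ - inner ℝ v₂ G)
      = 1 / 2 * inner ℝ (tensorL _ F G + tensorL _ G F) (c₁ - c₂) - inner ℝ (v₁ - v₂) G := by
    rw [inner_sub_right, inner_sub_left]
    ring
  rw [e]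
  have hT : ‖tensorL _ F G + tensorL _ G F‖ ≤ 2 * (A ^ 2 * ‖f‖ ^ 2) := by
    refine (norm_add_le _ _).trans ?_
    rw [norm_tensorL, norm_tensorL]
    have := mul_le_mul h0 h1 (norm_nonneg _) (by positivity)
    nlinarith [this]
  have h2 := (abs_real_inner_le_norm (tensorL _ F G + tensorL _ G F) (c₁ - c₂)).trans
    (mul_le_mul_of_nonneg_right hT (norm_nonneg _))
  have h3 := (abs_real_inner_le_norm (v₁ - v₂) G).trans
    (mul_le_mul_of_nonneg_left h1 (norm_nonneg _))
  have h4 := abs_sub (1 / 2 * inner ℝ (tensorL _ F G + tensorL _ G F) (c₁ - c₂))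
    (inner ℝ (v₁ - v₂) G)
  rw [abs_mul, abs_of_pos (by norm_num : (0 : ℝ) < 1 / 2)] at h4
  have h5 : 0 ≤ A * (‖c₁ - c₂‖ * ‖f‖ ^ 2) := by positivity
  have h6 : 0 ≤ A ^ 2 * (‖v₁ - v₂‖ * ‖f‖) := by positivity
  linarith

/-- The derivative of the scaled loss is locally Lipschitz in `f`, uniformly in `ξ`. -/
theorem exists_supLossDerivDiff_le_of_norm_sub {ρ : ℝ} (hρ0 : 0 < ρ) (hρ1 : ρ < 1) (i : Fin d) :
    ∃ A : ℝ, 0 ≤ A ∧ ∀ (C : K.NativeSpace →L[ℝ] K.NativeSpace) (c : HilbertTensor K.NativeSpace)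
      (g v f₁ f₂ : K.NativeSpace), K.OpRep ρ C c → K.VecRep ρ g v →
      K.supLossDerivDiff C C g g f₁ f₂ i ≤
        ENNReal.ofReal (A * ((‖f₁‖ + ‖f₂‖) * ‖c‖ + ‖v‖) * ‖f₁ - f₂‖) := by
  obtain ⟨A, hA0, hA⟩ := K.exists_bound_dilated hρ0 hρ1 i
  refine ⟨A ^ 2 + A, by positivity, fun C c g v f₁ f₂ hC hg => ?_⟩
  refine iSup₂_le fun ξ hξ => ENNReal.ofReal_le_ofReal ?_
  rw [lossDeriv_eq hρ0 hρ1 hC hg f₁ hξ, lossDeriv_eq hρ0 hρ1 hC hg f₂ hξ, repLossDeriv,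
    repLossDeriv]
  obtain ⟨h0, h1⟩ := hA ξ hξ f₁
  obtain ⟨h0', h1'⟩ := hA ξ hξ f₂
  obtain ⟨k0, k1⟩ := hA ξ hξ (f₁ - f₂)
  rw [map_sub] at k0 k1
  rw [smul_sub] at k1
  set F := K.monoOp 0 (ρ • ξ) f₁
  set G := ρ • K.monoOp (Pi.single i 1) (ρ • ξ) f₁
  set F' := K.monoOp 0 (ρ • ξ) f₂
  set G' := ρ • K.monoOp (Pi.single i 1) (ρ • ξ) f₂
  set T := tensorL K.NativeSpace
  have e : 1 / 2 * inner ℝ (T F G + T G F) c - inner ℝ v G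
      - (1 / 2 * inner ℝ (T F' G' + T G' F') c - inner ℝ v G')
      = 1 / 2 * inner ℝ (T (F - F') G + T F' (G - G') + (T (G - G') F + T G' (F - F'))) c
        - inner ℝ v (G - G') := by
    simp only [map_sub, inner_add_left, inner_sub_left, inner_sub_right,
      sub_apply]
    ring
  rw [e]
  have hT : ‖T (F - F') G + T F' (G - G') + (T (G - G') F + T G' (F - F'))‖
      ≤ 2 * (A ^ 2 * (‖f₁‖ + ‖f₂‖) * ‖f₁ - f₂‖) := by
    refine (norm_add_le _ _).trans ((add_le_add (norm_add_le _ _) (norm_add_le _ _)).trans ?_)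
    simp only [T, norm_tensorL]
    have m1 := mul_le_mul k0 h1 (norm_nonneg _) (by positivity)
    have m2 := mul_le_mul h0' k1 (norm_nonneg _) (by positivity)
    have m3 := mul_le_mul k1 h0 (norm_nonneg _) (by positivity)
    have m4 := mul_le_mul h1' k0 (norm_nonneg _) (by positivity)
    nlinarith [m1, m2, m3, m4]
  have h2 := (abs_real_inner_le_norm _ c).trans (mul_le_mul_of_nonneg_right hT (norm_nonneg c))
  have h3 := (abs_real_inner_le_norm v (G - G')).trans
    (mul_le_mul_of_nonneg_left k1 (norm_nonneg _))
  have h4 := abs_sub (1 / 2 * inner ℝ (T (F - F') G + T F' (G - G')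
    + (T (G - G') F + T G' (F - F'))) c) (inner ℝ v (G - G'))
  rw [abs_mul, abs_of_pos (by norm_num : (0 : ℝ) < 1 / 2)] at h4
  have h5 : 0 ≤ A * ((‖f₁‖ + ‖f₂‖) * ‖c‖ * ‖f₁ - f₂‖) := by positivity
  have h6 : 0 ≤ A ^ 2 * (‖v‖ * ‖f₁ - f₂‖) := by positivity
  linarith

/-! ### Representation of the empirical and the expected terms -/

variable {Z : Set (Fin d → ℝ)}

/-- The tensor that represents `∑_{I ∈ 𝓘} h_I(z) ∂_I k(z,·) ⊗ ∂_I k(z,·)`, see `opRep_opTerm`. -/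
def tensorTerm (ρ : ℝ) (𝓘 : Finset (Multiset (Fin d))) (h : Multiset (Fin d) → Z → ℝ) (z : Z) :
    HilbertTensor K.NativeSpace :=
  ∑ I ∈ 𝓘, h I z • tensorL _ (K.undilKernelDeriv ρ I z) (K.undilKernelDeriv ρ I z)

/-- The vector that represents `∑_{J ∈ 𝓙} h_J(z) ∂_J k(z,·)`, see `vecRep_vecTerm`. -/
def undilVecTerm (ρ : ℝ) (𝓙 : Finset (Multiset (Fin d))) (h : Multiset (Fin d) → Z → ℝ) (z : Z) :
    K.NativeSpace :=
  ∑ J ∈ 𝓙, h J z • K.undilKernelDeriv ρ J z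

variable {K} {ρ : ℝ}

theorem opRep_opTerm (hρ0 : 0 < ρ) (hρ1 : ρ < 1) (𝓘 : Finset (Multiset (Fin d)))
    (h : Multiset (Fin d) → Z → ℝ) {z : Z} (hz : ‖(z : Fin d → ℝ)‖ < ρ) :
    K.OpRep ρ (K.opTerm 𝓘 h z) (K.tensorTerm ρ 𝓘 h z) := by
  intro a b
  simp only [opTerm, tensorTerm, sum_apply, smul_apply,
    inner_sum, inner_smul_right]
  refine Finset.sum_congr rfl fun I _ => ?_
  rw [InnerProductSpace.inner_right_rankOne_apply, inner_tensorL,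
    ← K.dil_undilKernelDeriv hρ0 hρ1 I hz, K.inner_monoOp_right, real_inner_comm b,
    K.inner_monoOp_right]

theorem vecRep_vecTerm (hρ0 : 0 < ρ) (hρ1 : ρ < 1) (𝓙 : Finset (Multiset (Fin d)))
    (h : Multiset (Fin d) → Z → ℝ) {z : Z} (hz : ‖(z : Fin d → ℝ)‖ < ρ) :
    K.VecRep ρ (K.vecTerm 𝓙 h z) (K.undilVecTerm ρ 𝓙 h z) := by
  intro a
  simp only [vecTerm, undilVecTerm, sum_inner, inner_smul_left]
  refine Finset.sum_congr rfl fun J _ => ?_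
  rw [← K.dil_undilKernelDeriv hρ0 hρ1 J hz, K.inner_monoOp_right]

theorem OpRep.avg {C : ℕ → K.NativeSpace →L[ℝ] K.NativeSpace}
    {c : ℕ → HilbertTensor K.NativeSpace} (hC : ∀ l, K.OpRep ρ (C l) (c l)) (n : ℕ) :
    K.OpRep ρ ((n : ℝ)⁻¹ • ∑ l ∈ Finset.range n, C l) ((n : ℝ)⁻¹ • ∑ l ∈ Finset.range n, c l) := by
  intro a b
  simp only [smul_apply, sum_apply, inner_smul_right,
    inner_sum, hC _ a b]

theorem VecRep.avg {g v : ℕ → K.NativeSpace} (hg : ∀ l, K.VecRep ρ (g l) (v l)) (n : ℕ) :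
    K.VecRep ρ ((n : ℝ)⁻¹ • ∑ l ∈ Finset.range n, g l)
      ((n : ℝ)⁻¹ • ∑ l ∈ Finset.range n, v l) := by
  intro a
  simp only [inner_smul_left, sum_inner, hg _ a]

theorem OpRep.integral {X : Type*} [MeasurableSpace X] {P : Measure X}
    {C : X → K.NativeSpace →L[ℝ] K.NativeSpace} {c : X → HilbertTensor K.NativeSpace}
    (hC : ∀ z, K.OpRep ρ (C z) (c z)) (hCi : Integrable C P) (hci : Integrable c P) :
    K.OpRep ρ (∫ z, C z ∂P) (∫ z, c z ∂P) := by
  intro a b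
  rw [ContinuousLinearMap.integral_apply hCi, ← integral_inner (hCi.apply_continuousLinearMap b),
    ← integral_inner hci]
  exact integral_congr_ae (Eventually.of_forall fun z => hC z a b)

theorem VecRep.integral {X : Type*} [MeasurableSpace X] {P : Measure X} {g v : X → K.NativeSpace}
    (hg : ∀ z, K.VecRep ρ (g z) (v z)) (hgi : Integrable g P) (hvi : Integrable v P) :
    K.VecRep ρ (∫ z, g z ∂P) (∫ z, v z ∂P) := by
  intro a
  rw [real_inner_comm, ← integral_inner hgi, real_inner_comm _ (∫ z, v z ∂P),
    ← integral_inner hvi]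
  refine integral_congr_ae (Eventually.of_forall fun z => ?_)
  change inner ℝ a (g z) = inner ℝ _ (v z)
  rw [real_inner_comm, hg z a, real_inner_comm]

end PSWeights

/-! ### Measurability and boundedness of the terms -/

theorem exists_bound_sum_smul {E : Type*} [NormedAddCommGroup E] [NormedSpace ℝ E] {X ι : Type*}
    (s : Finset ι) {h : ι → X → ℝ} {φ : ι → X → E} (hh : ∀ I ∈ s, ∃ B : ℝ, ∀ z, |h I z| ≤ B)
    (hφ : ∀ I ∈ s, ∃ B : ℝ, ∀ z, ‖φ I z‖ ≤ B) :
    ∃ B : ℝ, 0 ≤ B ∧ ∀ z, ‖∑ I ∈ s, h I z • φ I z‖ ≤ B := by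
  choose! B hB using hh
  choose! B' hB' using hφ
  refine ⟨∑ I ∈ s, |B I| * |B' I|, by positivity, fun z => norm_sum_le_of_le _ fun I hI => ?_⟩
  rw [norm_smul]
  exact mul_le_mul ((hB I hI z).trans (le_abs_self _)) ((hB' I hI z).trans (le_abs_self _))
    (norm_nonneg _) (abs_nonneg _)

theorem aestronglyMeasurable_sum_smul {E : Type*} [NormedAddCommGroup E] [NormedSpace ℝ E]
    {X ι : Type*} [TopologicalSpace X] [SecondCountableTopology X] [MeasurableSpace X]
    [OpensMeasurableSpace X] (P : Measure X) (s : Finset ι) {h : ι → X → ℝ} {φ : ι → X → E}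
    (hh : ∀ I ∈ s, Measurable (h I)) (hφ : ∀ I ∈ s, Continuous (φ I)) :
    AEStronglyMeasurable (fun z => ∑ I ∈ s, h I z • φ I z) P := by
  borelize E
  refine (Finset.stronglyMeasurable_fun_sum s fun I hI => ?_).aestronglyMeasurable
  exact (hh I hI).stronglyMeasurable.smul (hφ I hI).stronglyMeasurable

namespace PSWeights

variable {d : ℕ} {K : PSWeights d} {Z : Set (Fin d → ℝ)} {ρ : ℝ}

theorem continuous_kernelDeriv (hZ : Z ⊆ openCube d) (I : Multiset (Fin d)) :
    Continuous fun z : Z => K.kernelDeriv I z := by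
  have h := (K.continuousOn_monoOp (fun i => I.count i) K.cornerFeature).comp_continuous
    continuous_subtype_val (fun z : Z => hZ z.2)
  exact h.congr fun z => (K.kernelDeriv_eq I (hZ z.2)).symm

theorem continuous_undilKernelDeriv (hρ0 : 0 < ρ) (hZ : ∀ z ∈ Z, ‖z‖ < ρ) (I : Multiset (Fin d)) :
    Continuous fun z : Z => K.undilKernelDeriv ρ I z :=
  ((K.continuousOn_monoOp (fun i => I.count i) K.cornerFeature).comp_continuous
    (continuous_subtype_val.const_smul ρ⁻¹)
    (fun z : Z => inv_smul_mem_openCube hρ0 (hZ z z.2))).const_smul (ρ ^ ∑ j, I.count j)⁻¹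

end PSWeights

/-! ### Averages of independent bounded random vectors -/

section Concentration

variable {E S Ω : Type*} [NormedAddCommGroup E] [InnerProductSpace ℝ E] [CompleteSpace E]
  [MeasurableSpace S] [MeasurableSpace Ω] {μ : Measure Ω} {P : Measure S}
  [IsProbabilityMeasure μ] [IsProbabilityMeasure P]

/-- The mean square error of the average of `n` independent copies of a random vector `X` of norm
at most `B` is at most `(2B)²/n`: the centred summands are orthogonal in mean square. -/
theorem integral_norm_sq_avg_sub_le {X : S → E} {B : ℝ} (hX : AEStronglyMeasurable X P)
    (hB : ∀ z, ‖X z‖ ≤ B) {x : ℕ → Ω → S} (hx : ∀ l, HasLaw (x l) P μ) (hind : iIndepFun x μ)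
    {n : ℕ} (hn : 0 < n) :
    Integrable (fun ω => ‖(n : ℝ)⁻¹ • ∑ l ∈ Finset.range n, X (x l ω) - ∫ z, X z ∂P‖ ^ 2) μ ∧
    ∫ ω, ‖(n : ℝ)⁻¹ • ∑ l ∈ Finset.range n, X (x l ω) - ∫ z, X z ∂P‖ ^ 2 ∂μ
      ≤ (2 * B) ^ 2 / n := by
  set m := ∫ z, X z ∂P with hm
  have hXi : Integrable X P := Integrable.of_bound hX B (Eventually.of_forall hB)
  have hmB : ‖m‖ ≤ B := by
    simpa using norm_integral_le_of_norm_le_const (μ := P) (Eventually.of_forall hB)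
  set Y : S → E := fun z => X z - m with hY
  have hYi : Integrable Y P := hXi.sub (integrable_const m)
  have hYB : ∀ z, ‖Y z‖ ≤ 2 * B := fun z => by
    refine (norm_sub_le _ _).trans ?_
    linarith [hB z]
  have hY0 : ∫ z, Y z ∂P = 0 := by
    rw [hY, integral_sub hXi (integrable_const m)]
    simp [hm]
  have hYm : ∀ l, AEStronglyMeasurable (fun ω => Y (x l ω)) μ := fun l => by
    refine AEStronglyMeasurable.comp_aemeasurable (g := Y) ?_ (hx l).aemeasurable
    rw [(hx l).map_eq]
    exact hYi.1
  have hinner : ∀ k l, Integrable (fun ω => inner ℝ (Y (x k ω)) (Y (x l ω))) μ := fun k l =>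
    Integrable.of_bound ((hYm k).inner (hYm l)) (2 * B * (2 * B)) (Eventually.of_forall fun ω =>
      (norm_inner_le_norm _ _).trans (mul_le_mul (hYB _) (hYB _) (norm_nonneg _)
        ((norm_nonneg _).trans (hYB (x k ω)))))
  have hoff : ∀ k l, k ≠ l → ∫ ω, inner ℝ (Y (x k ω)) (Y (x l ω)) ∂μ = 0 := by
    intro k l hkl
    have h := (hind.indepFun hkl).integral_bilin_comp_comp (f := Y) (g := Y) (𝕜 := ℝ)
      (hx k).aemeasurable (hx l).aemeasurable (by rwa [(hx k).map_eq]) (by rwa [(hx l).map_eq])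
      (innerSL ℝ)
    change ∫ ω, inner ℝ (Y (x k ω)) (Y (x l ω)) ∂μ = inner ℝ _ _ at h
    have h0 : ∫ ω, Y (x k ω) ∂μ = 0 := by
      rw [← hY0, ← (hx k).map_eq, integral_map (hx k).aemeasurable (by
        rw [(hx k).map_eq]; exact hYi.1)]
    rw [h, h0, inner_zero_left]
  have hn0 : (n : ℝ) ≠ 0 := by positivity
  have hexp : ∀ ω, ‖(n : ℝ)⁻¹ • ∑ l ∈ Finset.range n, X (x l ω) - m‖ ^ 2 = ((n : ℝ)⁻¹) ^ 2 *
      ∑ k ∈ Finset.range n, ∑ l ∈ Finset.range n, inner ℝ (Y (x k ω)) (Y (x l ω)) := by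
    intro ω
    have h1 : (n : ℝ)⁻¹ • ∑ l ∈ Finset.range n, X (x l ω) - m
        = (n : ℝ)⁻¹ • ∑ l ∈ Finset.range n, Y (x l ω) := by
      rw [hY, Finset.sum_sub_distrib, smul_sub, Finset.sum_const, Finset.card_range,
        ← Nat.cast_smul_eq_nsmul ℝ, inv_smul_smul₀ hn0]
    rw [h1, norm_smul, mul_pow, norm_inv, Real.norm_natCast, ← real_inner_self_eq_norm_sq,
      sum_inner]
    simp_rw [inner_sum]
  simp_rw [hexp]
  have hint : Integrable (fun ω => ∑ k ∈ Finset.range n, ∑ l ∈ Finset.range n,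
      inner ℝ (Y (x k ω)) (Y (x l ω))) μ :=
    integrable_finsetSum _ fun k _ => integrable_finsetSum _ fun l _ => hinner k l
  refine ⟨hint.const_mul _, ?_⟩
  rw [integral_const_mul, integral_finsetSum _ fun k _ =>
    integrable_finsetSum _ fun l _ => hinner k l]
  have hdiag : ∀ k ∈ Finset.range n, ∫ ω, ∑ l ∈ Finset.range n, inner ℝ (Y (x k ω)) (Y (x l ω)) ∂μ
      ≤ (2 * B) ^ 2 := by
    intro k hk
    rw [integral_finsetSum _ fun l _ => hinner k l,
      Finset.sum_eq_single_of_mem k hk fun l _ hl => hoff k l hl.symm]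
    refine (integral_mono (hinner k k) (integrable_const ((2 * B) ^ 2)) fun ω => ?_).trans_eq
      (by simp)
    change inner ℝ (Y (x k ω)) (Y (x k ω)) ≤ _
    rw [real_inner_self_eq_norm_sq]
    exact pow_le_pow_left₀ (norm_nonneg _) (hYB _) 2
  calc ((n : ℝ)⁻¹) ^ 2 * ∑ k ∈ Finset.range n,
        ∫ ω, ∑ l ∈ Finset.range n, inner ℝ (Y (x k ω)) (Y (x l ω)) ∂μ
      ≤ ((n : ℝ)⁻¹) ^ 2 * ∑ k ∈ Finset.range n, (2 * B) ^ 2 := by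
        gcongr with k hk
        exact hdiag k hk
    _ = (2 * B) ^ 2 / n := by
        rw [Finset.sum_const, Finset.card_range, nsmul_eq_mul]
        field_simp

theorem measure_lt_norm_avg_sub_le {X : S → E} {B : ℝ} (hX : AEStronglyMeasurable X P)
    (hB : ∀ z, ‖X z‖ ≤ B) {x : ℕ → Ω → S} (hx : ∀ l, HasLaw (x l) P μ) (hind : iIndepFun x μ)
    {n : ℕ} (hn : 0 < n) {t : ℝ} (ht : 0 < t) :
    μ {ω | t < ‖(n : ℝ)⁻¹ • ∑ l ∈ Finset.range n, X (x l ω) - ∫ z, X z ∂P‖}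
      ≤ ENNReal.ofReal ((2 * B) ^ 2 / (n * t ^ 2)) := by
  obtain ⟨hint, hle⟩ := integral_norm_sq_avg_sub_le hX hB hx hind hn
  have h := mul_meas_ge_le_integral_of_nonneg
    (Eventually.of_forall fun ω => sq_nonneg _) hint (t ^ 2)
  have hsub : {ω | t < ‖(n : ℝ)⁻¹ • ∑ l ∈ Finset.range n, X (x l ω) - ∫ z, X z ∂P‖} ⊆
      {ω | t ^ 2 ≤ ‖(n : ℝ)⁻¹ • ∑ l ∈ Finset.range n, X (x l ω) - ∫ z, X z ∂P‖ ^ 2} :=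
    fun ω (hω : t < _) => pow_le_pow_left₀ ht.le hω.le 2
  refine (measure_mono hsub).trans ?_
  rw [← ofReal_measureReal]
  refine ENNReal.ofReal_le_ofReal ?_
  rw [← div_div, le_div_iff₀ (by positivity), mul_comm]
  exact h.trans hle

end Concentration

/-! ### Rates -/

/-- A null sequence is dominated along `s` by a positive non-increasing null sequence, if `s` tends
to infinity. -/
theorem exists_antitone_rate {a : ℕ → ℝ} (ha : Tendsto a atTop (𝓝 0))
    {s : ℕ → ℕ} (hs : Tendsto s atTop atTop) :
    ∃ δ : ℕ → ℝ, (∀ k, 0 < δ k) ∧ Antitone δ ∧ Tendsto δ atTop (𝓝 0) ∧ ∀ m, a m < δ (s m) := by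
  -- the supremum of `a` over the indices `m` with `s m ≥ k`
  set A : ℕ → ℝ := fun k => sSup ((fun m => |a m|) '' {m | k ≤ s m}) with hA
  obtain ⟨C, hC⟩ := ha.abs.bddAbove_range
  have hbdd : ∀ k, BddAbove ((fun m => |a m|) '' {m | k ≤ s m}) := fun k =>
    ⟨C, by rintro _ ⟨m, -, rfl⟩; exact hC ⟨m, rfl⟩⟩
  have hne : ∀ k, ((fun m => |a m|) '' {m | k ≤ s m}).Nonempty := fun k =>
    Set.Nonempty.image _ (hs.eventually_ge_atTop k).exists
  have hA0 : ∀ k, 0 ≤ A k := fun k => Real.sSup_nonneg (by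
    rintro _ ⟨m, -, rfl⟩; exact abs_nonneg _)
  have hAanti : Antitone A := fun k l hkl =>
    csSup_le_csSup (hbdd k) (hne l) (Set.image_mono fun m (hm : l ≤ s m) => hkl.trans hm)
  have hAlim : Tendsto A atTop (𝓝 0) := by
    rw [Metric.tendsto_atTop]
    intro ε hε
    obtain ⟨N, hN⟩ := Metric.tendsto_atTop.1 ha (ε / 2) (by positivity)
    refine ⟨(Finset.range N).sup s + 1, fun k hk => ?_⟩
    rw [Real.dist_eq, sub_zero, abs_of_nonneg (hA0 k)]
    refine lt_of_le_of_lt (csSup_le (hne k) ?_) (half_lt_self hε)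
    rintro _ ⟨m, hm, rfl⟩
    have hm' : N ≤ m := by
      by_contra hlt
      have h1 : s m ≤ (Finset.range N).sup s := Finset.le_sup (Finset.mem_range.2 (not_le.1 hlt))
      have h2 : k ≤ s m := hm
      omega
    have h3 := hN m hm'
    rw [Real.dist_eq, sub_zero] at h3
    exact h3.le
  refine ⟨fun k => A k + 1 / ((k : ℝ) + 1), fun k => ?_, fun k l hkl => ?_, ?_, fun m => ?_⟩
  · have := hA0 k
    positivity
  · exact add_le_add (hAanti hkl) (Nat.one_div_le_one_div hkl)
  · simpa using hAlim.add tendsto_one_div_add_atTop_nhds_zero_nat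
  · have h1 : |a m| ≤ A (s m) := le_csSup (hbdd _) ⟨m, le_refl (s m), rfl⟩
    have h2 : (0 : ℝ) < 1 / ((s m : ℝ) + 1) := by positivity
    exact ((le_abs_self _).trans h1).trans_lt (lt_add_of_pos_right _ h2)

/-- Convergence in measure comes with a rate that is a function of any given divergent sequence of
sample sizes. -/
theorem exists_rate_of_tendstoInMeasure {Ω E : Type*} [MeasurableSpace Ω] {μ : Measure Ω}
    [IsProbabilityMeasure μ] [SeminormedAddCommGroup E] {f : ℕ → Ω → E} {g : Ω → E}
    (h : TendstoInMeasure μ f atTop g) {s : ℕ → ℕ} (hs : Tendsto s atTop atTop) :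
    ∃ δ : ℕ → ℝ, (∀ k, 0 < δ k) ∧ Antitone δ ∧ Tendsto δ atTop (𝓝 0) ∧
      ∀ m, μ {ω | δ (s m) < ‖f m ω - g ω‖} ≤ ENNReal.ofReal (δ (s m)) := by
  rw [tendstoInMeasure_iff_norm] at h
  -- the Ky Fan distance between `f m` and `g`
  set V : ℕ → Set ℝ := fun m => {ε | 0 < ε ∧ μ {ω | ε ≤ ‖f m ω - g ω‖} ≤ ENNReal.ofReal ε} with hV
  have hbdd : ∀ m, BddBelow (V m) := fun m => ⟨0, fun ε hε => hε.1.le⟩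
  have h1 : ∀ m, (1 : ℝ) ∈ V m := fun m => ⟨one_pos, by simpa using prob_le_one⟩
  have hlim : Tendsto (fun m => sInf (V m)) atTop (𝓝 0) := by
    refine tendsto_order.2 ⟨fun a ha => Eventually.of_forall fun m => ha.trans_le
      (Real.sInf_nonneg fun ε hε => hε.1.le), fun a ha => ?_⟩
    have ha2 : 0 < a / 2 := half_pos ha
    filter_upwards [(h (a / 2) ha2).eventually_le_const (ENNReal.ofReal_pos.2 ha2)] with m hm
    exact (csInf_le (hbdd m) ⟨ha2, hm⟩).trans_lt (half_lt_self ha)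
  obtain ⟨δ, hδ0, hδa, hδl, hδ⟩ := exists_antitone_rate hlim hs
  refine ⟨δ, hδ0, hδa, hδl, fun m => ?_⟩
  obtain ⟨ε, hε, hεδ⟩ := exists_lt_of_csInf_lt ⟨1, h1 m⟩ (hδ m)
  exact (measure_mono fun ω (hω : δ (s m) < _) => hεδ.le.trans hω.le).trans
    (hε.2.trans (ENNReal.ofReal_le_ofReal hεδ.le))

theorem antitoneOn_sqrt_log_div_self :
    AntitoneOn (fun s : ℕ => √(Real.log s / s)) (Set.Ici 3) := by
  intro a ha b hb hab
  have h3 : ∀ c : ℕ, 3 ≤ c → Real.exp 1 ≤ c := fun c hc =>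
    Real.exp_one_lt_d9.le.trans ((by norm_num : (2.7182818286 : ℝ) ≤ 3).trans (by exact_mod_cast hc))
  exact Real.sqrt_le_sqrt (Real.log_div_self_antitoneOn (h3 a ha) (h3 b hb) (by exact_mod_cast hab))

theorem tendsto_sqrt_log_div_self :
    Tendsto (fun s : ℕ => √(Real.log s / s)) atTop (𝓝 0) := by
  have h : Tendsto (fun x : ℝ => Real.log x / x) atTop (𝓝 0) :=
    Real.isLittleO_log_id_atTop.tendsto_div_nhds_zero
  simpa using (h.comp tendsto_natCast_atTop_atTop).sqrt

theorem inv_sqrt_le_sqrt_log_div_self {s : ℕ} (hs : 3 ≤ s) :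
    (√(s : ℝ))⁻¹ ≤ √(Real.log s / s) := by
  rw [← Real.sqrt_inv]
  refine Real.sqrt_le_sqrt ?_
  rw [inv_eq_one_div]
  have h3 : (3 : ℝ) ≤ s := by exact_mod_cast hs
  have h1 : 1 ≤ Real.log s := by
    rw [Real.le_log_iff_exp_le (by linarith)]
    linarith [Real.exp_one_lt_d9]
  gcongr

/-! ### The rates of the empirical losses -/

theorem norm_avg_le {E : Type*} [NormedAddCommGroup E] [NormedSpace ℝ E] {u : ℕ → E} {B : ℝ}
    (hB0 : 0 ≤ B) (hB : ∀ l, ‖u l‖ ≤ B) (n : ℕ) :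
    ‖(n : ℝ)⁻¹ • ∑ l ∈ Finset.range n, u l‖ ≤ B := by
  rw [norm_smul, norm_inv, Real.norm_natCast]
  refine (mul_le_mul_of_nonneg_left (norm_sum_le_of_le _ fun l _ => hB l)
    (by positivity)).trans ?_
  rw [Finset.sum_const, Finset.card_range, nsmul_eq_mul]
  rcases n.eq_zero_or_pos with rfl | hn
  · simpa using hB0
  · rw [inv_mul_cancel_left₀ (by positivity)]

/-- A function bounded by a multiple of the distance to the limit, near the limit, is `O_P` of a
rate of convergence in probability. -/
theorem isBigOP_of_le_norm_sub {Ω E : Type*} [MeasurableSpace Ω] {μ : Measure Ω}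
    [SeminormedAddCommGroup E] {f : ℕ → Ω → E} {g : E} {X : ℕ → Ω → ℝ≥0∞} {r : ℕ → ℝ} {L : ℝ}
    (hL : 0 ≤ L) (hX : ∀ m ω, ‖f m ω - g‖ ≤ 1 → X m ω ≤ ENNReal.ofReal (L * ‖f m ω - g‖))
    (hr0 : ∀ m, 0 < r m) (hr : Tendsto r atTop (𝓝 0))
    (hμ : ∀ m, μ {ω | r m < ‖f m ω - g‖} ≤ ENNReal.ofReal (r m)) : IsBigOP μ X r := by
  intro ε hε
  refine ⟨L + 1, by positivity, ?_⟩
  filter_upwards [hr.eventually_le_const hε, hr.eventually_le_const one_pos] with m hmε hm1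
  refine (measure_mono fun ω (hω : _ < X m ω) => ?_).trans
    ((hμ m).trans (ENNReal.ofReal_le_ofReal hmε))
  by_contra hle
  have hle' : ‖f m ω - g‖ ≤ r m := not_lt.1 hle
  refine absurd (hX m ω (hle'.trans hm1)) (not_le.2 (lt_of_le_of_lt ?_ hω))
  have := hr0 m
  refine ENNReal.ofReal_le_ofReal (mul_le_mul (by linarith) hle' (norm_nonneg _) (by linarith))

/-- If two random errors have tails of the order of `1 / (n t²)` and `1 / (n' t²)`, then what they
dominate is `O_P(√(log s / s))` with `s = min n n'`; the proof bounds it at the scale `1 / √s`. -/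
theorem isBigOP_of_tail_le {Ω : Type*} [MeasurableSpace Ω] {μ : Measure Ω} {n n' : ℕ → ℕ}
    (hn : Tendsto n atTop atTop) (hn' : Tendsto n' atTop atTop) {U V : ℕ → Ω → ℝ}
    {X : ℕ → Ω → ℝ≥0∞} {L B B' : ℝ} (hL : 0 ≤ L) (hB : 0 ≤ B) (hB' : 0 ≤ B')
    (hX : ∀ m ω t, U m ω ≤ t → V m ω ≤ t → X m ω ≤ ENNReal.ofReal (L * t))
    (hU : ∀ m, 0 < n m → ∀ t, 0 < t → μ {ω | t < U m ω} ≤ ENNReal.ofReal (B / (n m * t ^ 2)))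
    (hV : ∀ m, 0 < n' m → ∀ t, 0 < t → μ {ω | t < V m ω} ≤ ENNReal.ofReal (B' / (n' m * t ^ 2))) :
    IsBigOP μ X fun m => √(Real.log ↑(min (n m) (n' m)) / ↑(min (n m) (n' m))) := by
  intro ε hε
  -- Chebyshev's inequality at the level `M / √s` leaves the probability `(B + B') / M²`
  set M := √((B + B') / ε) + 1 with hM
  have hM0 : 0 < M := by positivity
  have hMε : (B + B') / M ^ 2 ≤ ε := by
    have h1 : (B + B') / ε ≤ M ^ 2 := by
      rw [← Real.sq_sqrt (show 0 ≤ (B + B') / ε by positivity)]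
      exact pow_le_pow_left₀ (Real.sqrt_nonneg _) (by linarith) 2
    rw [div_le_iff₀ hε] at h1
    rw [div_le_iff₀ (by positivity)]
    linarith
  refine ⟨(L + 1) * M, by positivity, ?_⟩
  filter_upwards [hn.eventually_ge_atTop 3, hn'.eventually_ge_atTop 3] with m h3 h3'
  set s := min (n m) (n' m) with hs
  have hs3 : 3 ≤ s := le_min h3 h3'
  have hs0 : (0 : ℝ) < s := by exact_mod_cast (by omega : 0 < s)
  set t := M * (√(s : ℝ))⁻¹ with ht
  have ht0 : 0 < t := by positivity
  have ht2 : (s : ℝ) * t ^ 2 = M ^ 2 := by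
    rw [ht, mul_pow, inv_pow, Real.sq_sqrt hs0.le]
    field_simp
  have hsub : {ω | ENNReal.ofReal ((L + 1) * M * √(Real.log s / s)) < X m ω} ⊆
      {ω | t < U m ω} ∪ {ω | t < V m ω} := by
    intro ω hω
    by_contra hnot
    rw [Set.mem_union, not_or] at hnot
    refine absurd (hX m ω t (not_lt.1 hnot.1) (not_lt.1 hnot.2)) (not_le.2 (lt_of_le_of_lt ?_ hω))
    refine ENNReal.ofReal_le_ofReal ?_
    rw [ht, ← mul_assoc]
    exact mul_le_mul (by nlinarith) (inv_sqrt_le_sqrt_log_div_self hs3) (by positivity)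
      (by positivity)
  have hbound : ∀ (N : ℕ) (b : ℝ), 0 ≤ b → s ≤ N → b / (N * t ^ 2) ≤ b / M ^ 2 := by
    intro N b hb hN
    rw [← ht2]
    have : (s : ℝ) ≤ N := by exact_mod_cast hN
    gcongr
  refine (measure_mono hsub).trans ((measure_union_le _ _).trans ((add_le_add
    ((hU m (by omega) t ht0).trans (ENNReal.ofReal_le_ofReal (hbound _ _ hB (min_le_left _ _))))
    ((hV m (by omega) t ht0).trans (ENNReal.ofReal_le_ofReal
      (hbound _ _ hB' (min_le_right _ _))))).trans ?_))
  rw [← ENNReal.ofReal_add (by positivity) (by positivity), ← add_div]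
  exact ENNReal.ofReal_le_ofReal hMε

theorem lemma2 {d : ℕ} (K : PSWeights d)
    -- the domain: compact, inside the open cube, with the contraction condition
    (Z : Set (Fin d → ℝ)) (hZc : IsCompact Z) (hZ : Z ⊆ openCube d)
    (hcontr : ∀ ξ ∈ Set.Icc (0 : Fin d → ℝ) 1, ∀ z ∈ Z, ξ * z ∈ Z)
    -- the index families and the bounded weight functions
    (𝓘 𝓙 : Finset (Multiset (Fin d))) (h h' : Multiset (Fin d) → Z → ℝ)
    (hh_meas : ∀ I ∈ 𝓘, Measurable (h I)) (hh_bdd : ∀ I ∈ 𝓘, ∃ B : ℝ, ∀ z, |h I z| ≤ B)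
    (hh'_meas : ∀ J ∈ 𝓙, Measurable (h' J)) (hh'_bdd : ∀ J ∈ 𝓙, ∃ B : ℝ, ∀ z, |h' J z| ≤ B)
    -- the two i.i.d. samples, with laws `P` and `Q`
    (P Q : Measure Z) [IsProbabilityMeasure P] [IsProbabilityMeasure Q]
    {Ω : Type*} [MeasurableSpace Ω] (μ : Measure Ω) [IsProbabilityMeasure μ]
    (x y : ℕ → Ω → Z)
    (hx_law : ∀ l, HasLaw (x l) P μ) (hx_indep : iIndepFun x μ)
    (hy_law : ∀ l, HasLaw (y l) Q μ) (hy_indep : iIndepFun y μ)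
    -- the sample sizes along the asymptotics
    (n n' : ℕ → ℕ) (hn : Tendsto n atTop atTop) (hn' : Tendsto n' atTop atTop)
    -- the target, and an estimator that is consistent in the RKHS norm
    (fstar : K.NativeSpace) (fhat : ℕ → Ω → K.NativeSpace)
    (hcons : TendstoInMeasure μ fhat atTop (fun _ => fstar)) :
    -- the objects are well defined: `∂_I k(z,·)` has the values `∂_I k(·,u)` at `z`,
    (∀ (I : Multiset (Fin d)), ∀ z ∈ Z, ∀ u : openCube d,
      K.kernelDeriv I z u = partialMulti I (fun v => K.kernel v u) z) ∧
    -- the expectations `C` and `g` exist,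
    Integrable (K.opTerm 𝓘 h) P ∧ Integrable (K.vecTerm 𝓙 h') Q ∧
    -- and the empirical and the expected loss have partial derivatives on the closed cube
    (∀ (f : K.NativeSpace), ∀ ξ ∈ Set.Icc (0 : Fin d → ℝ) 1, ∀ i : Fin d,
      (∀ m ω, DifferentiableWithinAt ℝ
        (K.lossLine (K.empOp 𝓘 h (n m) (fun l => x l ω)) (K.empVec 𝓙 h' (n' m) (fun l => y l ω))
          f ξ i) (Set.Icc 0 1) (ξ i)) ∧
      DifferentiableWithinAt ℝ
        (K.lossLine (K.popOp 𝓘 h P) (K.popVec 𝓙 h' Q) f ξ i) (Set.Icc 0 1) (ξ i)) ∧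
    -- (a)
    (∃ δ : ℕ → ℝ, (∀ s, 0 < δ s) ∧ Antitone δ ∧ Tendsto δ atTop (𝓝 0) ∧
      ∀ i : Fin d, IsBigOP μ
        (fun m ω => K.supLossDerivDiff
          (K.empOp 𝓘 h (n m) (fun l => x l ω)) (K.empOp 𝓘 h (n m) (fun l => x l ω))
          (K.empVec 𝓙 h' (n' m) (fun l => y l ω)) (K.empVec 𝓙 h' (n' m) (fun l => y l ω))
          (fhat m ω) fstar i)
        (fun m => δ (min (n m) (n' m)))) ∧
    -- (b), with the rate `√(log s / s)`
    (∃ δ' : ℕ → ℝ, (∀ s, δ' s = √(Real.log s / s)) ∧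
      AntitoneOn δ' (Set.Ici 3) ∧ Tendsto δ' atTop (𝓝 0) ∧
      ∀ i : Fin d, IsBigOP μ
        (fun m ω => K.supLossDerivDiff
          (K.empOp 𝓘 h (n m) (fun l => x l ω)) (K.popOp 𝓘 h P)
          (K.empVec 𝓙 h' (n' m) (fun l => y l ω)) (K.popVec 𝓙 h' Q)
          fstar fstar i)
        (fun m => δ' (min (n m) (n' m)))) := by

  obtain ⟨r, hr0, hr1, hr⟩ := exists_norm_le_of_isCompact hZc hZ
  -- any radius strictly between that of `Z` and `1` does for the dilation
  obtain ⟨ρ, hrρ, hρ1⟩ := exists_between hr1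
  have hρ0 : 0 < ρ := hr0.trans hrρ
  have hzρ : ∀ z ∈ Z, ‖z‖ < ρ := fun z hz => (hr z hz).trans_lt hrρ
  have hcpt : CompactSpace Z := isCompact_iff_compactSpace.1 hZc
  have hbd : ∀ {E : Type} [NormedAddCommGroup E] {φ : Z → E}, Continuous φ →
      ∃ B : ℝ, ∀ z, ‖φ z‖ ≤ B := fun {E} _ {φ} hφ => by
    obtain ⟨B, hB⟩ := (isCompact_range hφ).isBounded.exists_norm_le
    exact ⟨B, fun z => hB _ ⟨z, rfl⟩⟩
  -- the terms and their representations are bounded and measurable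
  have hcu := fun I => PSWeights.continuous_undilKernelDeriv (K := K) hρ0 hzρ I
  have hck := fun I => PSWeights.continuous_kernelDeriv (K := K) hZ I
  have hcT : ∀ I, Continuous fun z : Z =>
      tensorL _ (K.undilKernelDeriv ρ I z) (K.undilKernelDeriv ρ I z) := fun I =>
    ((tensorL K.NativeSpace).continuous.comp (hcu I)).clm_apply (hcu I)
  have hcR : ∀ I, Continuous fun z : Z =>
      InnerProductSpace.rankOne ℝ (K.kernelDeriv I z) (K.kernelDeriv I z) := fun I =>
    ((InnerProductSpace.rankOne ℝ).continuous.comp (hck I)).clm_apply (hck I)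
  obtain ⟨B₁, -, hB₁⟩ := exists_bound_sum_smul 𝓘 hh_bdd fun I _ => hbd (hcR I)
  obtain ⟨B₂, -, hB₂⟩ := exists_bound_sum_smul 𝓙 hh'_bdd fun J _ => hbd (hck J)
  obtain ⟨B, hB0, hB⟩ := exists_bound_sum_smul 𝓘 hh_bdd fun I _ => hbd (hcT I)
  obtain ⟨B', hB'0, hB'⟩ := exists_bound_sum_smul 𝓙 hh'_bdd fun J _ => hbd (hcu J)
  have hCi : Integrable (K.opTerm 𝓘 h) P := Integrable.of_bound
    (aestronglyMeasurable_sum_smul P 𝓘 hh_meas fun I _ => hcR I) B₁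
    (Eventually.of_forall hB₁)
  have hgi : Integrable (K.vecTerm 𝓙 h') Q := Integrable.of_bound
    (aestronglyMeasurable_sum_smul Q 𝓙 hh'_meas fun J _ => hck J) B₂
    (Eventually.of_forall hB₂)
  have hcm : AEStronglyMeasurable (K.tensorTerm ρ 𝓘 h) P :=
    aestronglyMeasurable_sum_smul P 𝓘 hh_meas fun I _ => hcT I
  have hvm : AEStronglyMeasurable (K.undilVecTerm ρ 𝓙 h') Q :=
    aestronglyMeasurable_sum_smul Q 𝓙 hh'_meas fun J _ => hcu J
  have hC : ∀ z : Z, K.OpRep ρ (K.opTerm 𝓘 h z) (K.tensorTerm ρ 𝓘 h z) := fun z =>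
    PSWeights.opRep_opTerm hρ0 hρ1 𝓘 h (hzρ z z.2)
  have hg : ∀ z : Z, K.VecRep ρ (K.vecTerm 𝓙 h' z) (K.undilVecTerm ρ 𝓙 h' z) := fun z =>
    PSWeights.vecRep_vecTerm hρ0 hρ1 𝓙 h' (hzρ z z.2)
  have hCe : ∀ N (z : ℕ → Z), K.OpRep ρ (K.empOp 𝓘 h N z)
      ((N : ℝ)⁻¹ • ∑ l ∈ Finset.range N, K.tensorTerm ρ 𝓘 h (z l)) := fun N z =>
    PSWeights.OpRep.avg (fun l => hC (z l)) N
  have hge : ∀ N (z : ℕ → Z), K.VecRep ρ (K.empVec 𝓙 h' N z)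
      ((N : ℝ)⁻¹ • ∑ l ∈ Finset.range N, K.undilVecTerm ρ 𝓙 h' (z l)) := fun N z =>
    PSWeights.VecRep.avg (fun l => hg (z l)) N
  have hCp : K.OpRep ρ (K.popOp 𝓘 h P) (∫ z, K.tensorTerm ρ 𝓘 h z ∂P) :=
    PSWeights.OpRep.integral hC hCi (Integrable.of_bound hcm B (Eventually.of_forall hB))
  have hgp : K.VecRep ρ (K.popVec 𝓙 h' Q) (∫ z, K.undilVecTerm ρ 𝓙 h' z ∂Q) :=
    PSWeights.VecRep.integral hg hgi (Integrable.of_bound hvm B' (Eventually.of_forall hB'))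
  refine ⟨fun I z hz u => K.kernelDeriv_apply I (hZ hz) u, hCi, hgi, fun f ξ hξ i =>
    ⟨fun m ω => ?_, ?_⟩, ?_, fun s => √(Real.log s / s), fun s => rfl,
    antitoneOn_sqrt_log_div_self, tendsto_sqrt_log_div_self, fun i => ?_⟩
  · exact (PSWeights.hasDerivWithinAt_lossLine hρ0 hρ1 (hCe _ _) (hge _ _) f hξ
      i).differentiableWithinAt
  · exact (PSWeights.hasDerivWithinAt_lossLine hρ0 hρ1 hCp hgp f hξ i).differentiableWithinAt
  · have hs : Tendsto (fun m => min (n m) (n' m)) atTop atTop := tendsto_atTop.2 fun k => by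
      filter_upwards [hn.eventually_ge_atTop k, hn'.eventually_ge_atTop k] with m h₁ h₂
      exact le_min h₁ h₂
    obtain ⟨δ, hδ0, hδa, hδl, hδ⟩ := exists_rate_of_tendstoInMeasure hcons hs
    refine ⟨δ, hδ0, hδa, hδl, fun i => ?_⟩
    obtain ⟨A, hA0, hA⟩ := K.exists_supLossDerivDiff_le_of_norm_sub hρ0 hρ1 i
    refine isBigOP_of_le_norm_sub (L := A * ((2 * ‖fstar‖ + 1) * B + B')) (by positivity)
      (fun m ω hm => (hA _ _ _ _ _ _ (hCe _ _) (hge _ _)).trans (ENNReal.ofReal_le_ofReal ?_))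
      (fun m => hδ0 _) (hδl.comp hs) hδ
    have h1 : ‖fhat m ω‖ ≤ ‖fstar‖ + 1 := by
      have := norm_le_norm_add_norm_sub' (fhat m ω) fstar
      linarith
    have h2 := norm_avg_le hB0 (fun l => hB (x l ω)) (n m)
    have h3 := norm_avg_le hB'0 (fun l => hB' (y l ω)) (n' m)
    have h4 : ‖fhat m ω‖ + ‖fstar‖ ≤ 2 * ‖fstar‖ + 1 := by linarith
    exact mul_le_mul_of_nonneg_right (mul_le_mul_of_nonneg_left (add_le_add
      (mul_le_mul h4 h2 (norm_nonneg _) (by positivity)) h3) hA0) (norm_nonneg _)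
  · obtain ⟨A, hA0, hA⟩ := K.exists_supLossDerivDiff_le_of_rep hρ0 hρ1 i
    refine isBigOP_of_tail_le hn hn' (L := A * (‖fstar‖ ^ 2 + ‖fstar‖)) (B := (2 * B) ^ 2)
      (B' := (2 * B') ^ 2) (by positivity) (by positivity) (by positivity)
      (fun m ω t hU hV => (hA _ _ _ _ _ _ _ _ _ (hCe _ _) hCp (hge _ _) hgp).trans
        (ENNReal.ofReal_le_ofReal ?_))
      (fun m hm t ht => measure_lt_norm_avg_sub_le hcm hB hx_law hx_indep hm ht)
      (fun m hm t ht => measure_lt_norm_avg_sub_le hvm hB' hy_law hy_indep hm ht)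
    rw [mul_assoc, add_mul]
    have h1 := mul_le_mul_of_nonneg_right hU (sq_nonneg ‖fstar‖)
    have h2 := mul_le_mul_of_nonneg_right hV (norm_nonneg fstar)
    refine mul_le_mul_of_nonneg_left ?_ hA0
    linarith

end
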